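/- Strings are elements of $\{0,1\}^*$, sequences are elements of $\{0,1\}^\omega$, $S\upharpoonright n$ is the prefix of length $n$ of $S$, $x^m$ is the concatenation of $m$ copies of $x$, $x^{-1}$ is the reverse of $x$, and $\forall^\infty n$ means "for all but finitely many $n$". Fix a universal machine $U$ and let $K(x)$ be the plain Kolmogorov complexity of $x$ with respect to $U$. *Transducers.* A finite-state transducer (FST) is a deterministic one-way transducer $(Q,q_0,\delta,\nu)$ with $\delta:Q\times\{0,1\}\to Q$ and $\nu:Q\times\{0,1\}\to\{0,1\}^*$. A pebble transducer (PB) is a deterministic two-way finite-state transducer on the tape $\dashv x\vdash$ with finitely many pebbles used in a stack-like fashion: depending on the state, the symbol and the set of pebbles under the head, it writes a string, changes state, and moves right, moves left, pushes the next pebble onto the current square, or pops the last pushed pebble if that is on the current square; $T(x)=w$ if, started in $q_0$ on square $0$ with no pebble on the tape, it reaches a final state having written $w$. For $F\in\{\mathrm{FS},\mathrm{PB}\}$ let $\sigma_F$ be a binary representation, i.e. a map from an infinite set of strings onto the set of all FSTs, respectively all PBs (with states named canonically), and let $$D_F^k(x)=\min\{|y| : T(y)=x \text{ for some } T \text{ with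 a } \sigma_F\text{-description of length at most } k\}\in\mathbb N\cup\{\infty\}.$$ PB-depth$(S)\ge\alpha$ means $$(\forall k)(\exists k')(\forall^\infty n)\quad D_{\mathrm{FS}}^k(S\upharpoonright n)-D_{\mathrm{PB}}^{k'}(S\upharpoonright n)\ge\alpha n ,$$ where the inequality includes that $D_{\mathrm{PB}}^{k'}(S\upharpoonright n)$ is finite. *Pushdown compressors.* A pushdown compressor (PDC) is a deterministic finite-state machine with output and a stack over $\{0,1,z_0\}$, initially holding only the bottom symbol $z_0$, which is never popped. Depending on the state and the topmost stack symbol, it either reads an input bit $b$ and replaces the topmost symbol by a string, or makes a $\lambda$-transition, which reads nothing and pops the topmost symbol; in both cases it changes state and writes a string. For some $c\in\mathbb N$ at most $c$ successive $\lambda$-transitions are possible. $C(x)$ is the string written on input $x$, where all possible $\lambda$-transitions are made at the start and after each bit. $C$ is information lossless if the map from $x\in\{0,1\}^*$ to the pair of $C(x)$ and the state after reading $x$ is defined everywhere and injective. ILPDC is the class of information lossless PDCs, and ILUPDC is the same class for the stack alphabet $\{0,z_0\}$. PD-depth$(S)\ge\alpha$ means $$(\forall C\in\mathrm{ILUPDC})(\exists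 C'\in\mathrm{ILPDC})(\forall^\infty n)\quad |C(S\upharpoonright n)|-|C'(S\upharpoonright n)|\ge\alpha n .$$ **Statement.** For every $0<\beta<1/2$ there is a sequence $S$ such that, for all binary representations $\sigma_{\mathrm{FS}}$ and $\sigma_{\mathrm{PB}}$, $$\text{PB-depth}(S)\ge 1-\beta\qquad\text{and}\qquad \text{PD-depth}(S)\ge \tfrac12-\beta .$$ Moreover, $S$ can be taken of the form $S=S_1S_2S_3\cdots$ with $$S_j=R_j^{|R_j|}\,1^k\,(R_j^{-1})^{|R_j|},$$ where $k>8$ is an integer with $8/k\le\beta$ and, for each $j\ge1$, $R_j$ is a string of length $k\cdot k^{\lceil \log j/\log k\rceil}$ that does not contain $1^k$ as a substring and satisfies $K(R_j)\ge|R_j|\,(1-\tfrac1k)$. -/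

import Mathlib

open Filter

namespace PebbleDepth

/-! ## Strings and sequences -/

/-- Strings are finite lists of bits. -/
abbrev Str : Type := List Bool

/-- Sequences are infinite sequences of bits. -/
abbrev BitSeq : Type := ℕ → Bool

/-- The prefix of length `n` of the sequence `S`. -/
def seqPrefix (S : BitSeq) (n : ℕ) : Str := (List.range n).map S

/-- `x` concatenated with itself `n` times. -/
def strPow (x : Str) (n : ℕ) : Str := (List.replicate n x).flatten

/-- The string `R ^ |R| 1 ^ k (R⁻¹) ^ |R|`, where `R⁻¹` is the reverse of `R`. -/
def block (k : ℕ) (R : Str) : Str :=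
  strPow R R.length ++ List.replicate k true ++ strPow R.reverse R.length

/-- `S` is the infinite concatenation `B 1 B 2 B 3 ⋯`: for every `m` the string
`B 1 B 2 ⋯ B m` is a prefix of `S`. (If infinitely many `B j` are nonempty, this determines
`S`.) -/
def IsConcatenation (S : BitSeq) (B : ℕ → Str) : Prop :=
  ∀ m : ℕ, seqPrefix S ((List.range m).flatMap fun j => B (j + 1)).length =
    (List.range m).flatMap fun j => B (j + 1)

/-! ## Plain Kolmogorov complexity -/

/-- `U` is a universal machine for plain Kolmogorov complexity: it is partial computable, and up
to an additive constant its descriptions are no longer than those of any other partial computable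
machine. -/
structure IsUniversal (U : Str →. Str) : Prop where
  partrec : Partrec U
  optimal : ∀ f : Str →. Str, Partrec f →
    ∃ c : ℕ, ∀ y x : Str, x ∈ f y → ∃ z : Str, z.length ≤ y.length + c ∧ x ∈ U z

/-- `K_U(x)`, the length of a shortest `y` with `U(y) = x`. For universal `U` such a `y` always
exists. -/
noncomputable def kolmogorov (U : Str →. Str) (x : Str) : ℕ :=
  sInf {m : ℕ | ∃ y : Str, x ∈ U y ∧ y.length = m}

/-! ## Finite-state transducers -/

/-- A finite-state transducer. The finite set of states is taken to be `{0, …, numStates - 1}`;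
it is nonempty because it contains `start`. -/
structure FST where
  numStates : ℕ
  start : Fin numStates
  δ : Fin numStates → Bool → Fin numStates
  ν : Fin numStates → Bool → Str

/-- The state after reading `x`. -/
def FST.stateAfter (T : FST) (x : Str) : Fin T.numStates := x.foldl T.δ T.start

/-- The output from state `q` on input `x`. -/
def FST.outputFrom (T : FST) : Fin T.numStates → Str → Str
  | _, [] => []
  | q, b :: x => T.ν q b ++ T.outputFrom (T.δ q b) x

/-- The output `T(x)`. -/
def FST.output (T : FST) (x : Str) : Str := T.outputFrom T.start x

/-! ## Pebble transducers -/

/-- The content of a tape square: one of the two end markers or a bit. -/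
inductive TapeSymbol where
  | leftEnd : TapeSymbol
  | bit : Bool → TapeSymbol
  | rightEnd : TapeSymbol

/-- The actions of a pebble transducer. -/
inductive PebbleAction where
  | right : PebbleAction
  | left : PebbleAction
  | push : PebbleAction
  | pop : PebbleAction

/-- A deterministic pebble transducer. The finite set of states is taken to be
`{0, …, numStates - 1}`; the transition and output functions are defined on nonfinal states. -/
structure PebbleTransducer where
  numStates : ℕ
  start : Fin numStates
  final : Finset (Fin numStates)
  numPebbles : ℕ
  δ : {q : Fin numStates // q ∉ final} → TapeSymbol → (Fin numPebbles → Bool) →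
    Fin numStates × PebbleAction
  ν : {q : Fin numStates // q ∉ final} → TapeSymbol → (Fin numPebbles → Bool) → Str

/-- The content of square `i` of the tape for input `x`, whose squares `0, 1, …, |x|, |x| + 1` hold
the left end marker, the bits of `x` and the right end marker. -/
def tapeSymbol (x : Str) (i : ℕ) : TapeSymbol :=
  if i = 0 then .leftEnd
  else match x[i - 1]? with
    | some b => .bit b
    | none => .rightEnd

/-- A configuration: state, head position, pebble positions, and the output so far. The list
`pebbles` has as its entries the squares of the pebbles `1, …, l` that are on the tape, in this
order; the remaining pebbles are off the tape. -/
structure PebbleTransducer.Config (T : PebbleTransducer) where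
  state : Fin T.numStates
  head : ℕ
  pebbles : List ℕ
  out : Str

/-- Which pebbles are on the square under the head. -/
def PebbleTransducer.Config.here {T : PebbleTransducer} (c : T.Config) :
    Fin T.numPebbles → Bool :=
  fun j => decide (c.pebbles[(j : ℕ)]? = some c.head)

/-- Head and pebbles after an action; `none` if the action is impossible. -/
def PebbleTransducer.act (T : PebbleTransducer) (a : TapeSymbol) (i : ℕ) (p : List ℕ) :
    PebbleAction → Option (ℕ × List ℕ)
  | .right => match a with
    | .rightEnd => none
    | _ => some (i + 1, p)
  | .left => match a with
    | .leftEnd => none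
    | _ => some (i - 1, p)
  | .push => if p.length < T.numPebbles then some (i, p ++ [i]) else none
  | .pop => if p.getLast? = some i then some (i, p.dropLast) else none

/-- The successor configuration on input `x`, if there is one. -/
def PebbleTransducer.step (T : PebbleTransducer) (x : Str) (c : T.Config) : Option T.Config :=
  if h : c.state ∈ T.final then none
  else
    let a := tapeSymbol x c.head
    let r := T.δ ⟨c.state, h⟩ a c.here
    (T.act a c.head c.pebbles r.2).map fun m =>
      { state := r.1, head := m.1, pebbles := m.2, out := c.out ++ T.ν ⟨c.state, h⟩ a c.here }

/-- The initial configuration. -/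
def PebbleTransducer.init (T : PebbleTransducer) : T.Config :=
  { state := T.start, head := 0, pebbles := [], out := [] }

/-- `T(x) = w`: started on `x`, the transducer reaches a final state having written `w`. -/
def PebbleTransducer.Outputs (T : PebbleTransducer) (x w : Str) : Prop :=
  ∃ c : T.Config, Relation.ReflTransGen (fun c₁ c₂ => T.step x c₁ = some c₂) T.init c ∧
    c.state ∈ T.final ∧ c.out = w

/-! ## Complexity relative to a class of transducers -/

/-- A binary representation of the members of `F`: a surjection onto `F` from an infinite set of
strings. Computability is not demanded, so that a claim about all representations covers the
computable ones in particular. -/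
structure BinaryRep (F : Type) where
  dom : Set Str
  infinite_dom : dom.Infinite
  toFun : dom → F
  surjective : Function.Surjective toFun

/-- The size of `T`: the length of a shortest description of `T`. -/
noncomputable def BinaryRep.size {F : Type} (σ : BinaryRep F) (T : F) : ℕ :=
  sInf {m : ℕ | ∃ x : σ.dom, σ.toFun x = T ∧ (x : Str).length = m}

/-- The `k`-complexity of `x`, where `Out T y x` says that `T` outputs `x` on input `y`: the least
length of a `y` from which some `T` of size at most `k` produces `x`, and `∞` if there is none. -/
noncomputable def BinaryRep.complexity {F : Type} (σ : BinaryRep F) (Out : F → Str → Str → Prop)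
    (k : ℕ) (x : Str) : ℕ∞ :=
  ⨅ (y : Str) (_ : ∃ T : F, σ.size T ≤ k ∧ Out T y x), (y.length : ℕ∞)

/-- The `k`-FS complexity. -/
noncomputable def fsComplexity (σ : BinaryRep FST) (k : ℕ) (x : Str) : ℕ∞ :=
  σ.complexity (fun T y x => T.output y = x) k x

/-- The `k`-PB complexity. -/
noncomputable def pbComplexity (τ : BinaryRep PebbleTransducer) (k : ℕ) (x : Str) : ℕ∞ :=
  τ.complexity PebbleTransducer.Outputs k x

/-- The embedding of `ℕ ∪ {∞}` into the extended reals. -/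
noncomputable def toEReal (m : ℕ∞) : EReal := ((m : ENNReal) : EReal)

/-- PB-depth of `S` is at least `α`. In the extended reals `∞ - ∞ = -∞`, so the inequality never
holds where the `k'`-PB complexity is infinite. -/
def PBDepthGE (σ : BinaryRep FST) (τ : BinaryRep PebbleTransducer) (S : BitSeq) (α : ℝ) : Prop :=
  ∀ k : ℕ, ∃ k' : ℕ, ∀ᶠ n : ℕ in atTop,
    toEReal (fsComplexity σ k (seqPrefix S n)) - toEReal (pbComplexity τ k' (seqPrefix S n)) ≥
      ((α * n : ℝ) : EReal)

/-! ## Pushdown compressors -/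

/-- The data of a pushdown compressor whose stack alphabet consists of the elements `some a` with
`a : A` and of the bottom-of-stack symbol `z₀ = none`. The second argument of `δ` and `ν` is
`some b` if the bit `b` is read and `none` in a `λ`-transition. The transition function may be
undefined. In `δ q b a = some (q', w)` the string `w` replaces the topmost stack symbol `a`. -/
structure PDCData (A : Type) where
  State : Type
  finite_state : Finite State
  δ : State → Option Bool → Option A → Option (State × List (Option A))
  ν : State → Option Bool → Option A → Str
  start : State
  c : ℕ

/-- A configuration: state, stack (topmost symbol first), and the output so far. -/
structure PDCData.Config {A : Type} (C : PDCData A) where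
  state : C.State
  stack : List (Option A)
  out : Str

/-- One transition, reading a bit (`b = some _`) or nothing (`b = none`). -/
def PDCData.step {A : Type} (C : PDCData A) (b : Option Bool) (x : C.Config) : Option C.Config :=
  match x.stack with
  | [] => none
  | a :: s => (C.δ x.state b a).map fun r =>
      { state := r.1, stack := r.2 ++ s, out := x.out ++ C.ν x.state b a }

/-- Perform `λ`-transitions as long as they are possible, at most `m` of them. -/
def PDCData.lambdaRun {A : Type} (C : PDCData A) : ℕ → C.Config → C.Config
  | 0, x => x
  | m + 1, x => match C.step none x with
    | none => x
    | some y => C.lambdaRun m y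

/-- A pushdown compressor. -/
structure PDC (A : Type) extends PDCData A where
  /-- The bottom-of-stack symbol is never popped. -/
  keep_bottom : ∀ q b q' w, δ q b none = some (q', w) → ∃ v, w = v ++ [none]
  /-- A `λ`-transition pops the topmost stack symbol. -/
  lambda_pop : ∀ q a q' w, δ q none a = some (q', w) → w = []
  /-- Determinism. -/
  deterministic : ∀ q a, δ q none a = none ∨ ∀ b : Bool, δ q (some b) a = none
  /-- At most `c` successive `λ`-transitions are possible. -/
  lambda_bound : ∀ x : toPDCData.Config,
    toPDCData.step none (toPDCData.lambdaRun c x) = none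

/-- The configuration after reading `x` from the initial configuration, where all possible
`λ`-transitions are performed at the start and after each bit; `none` if the compressor gets
stuck. -/
def PDC.run {A : Type} (C : PDC A) (x : Str) : Option C.Config :=
  x.foldl (fun o b => o.bind fun y => (C.step (some b) y).map (C.lambdaRun C.c))
    (some (C.lambdaRun C.c { state := C.start, stack := [none], out := [] }))

/-- The output `C(x)`; it is only used for compressors that never get stuck. -/
def PDC.output {A : Type} (C : PDC A) (x : Str) : Str :=
  match C.run x with
  | some y => y.out
  | none => []

/-- `C` is information lossless: `x ↦ (C(x), δ_Q(x))` is defined for all strings and injective. -/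
def PDC.IsLossless {A : Type} (C : PDC A) : Prop :=
  (∀ x : Str, ∃ y, C.run x = some y) ∧
  Function.Injective fun x : Str => (C.run x).map fun y => (y.out, y.state)

/-- Pushdown compressors: stack alphabet `{0, 1, z₀}`. -/
abbrev PushdownCompressor : Type 1 := PDC Bool

/-- Unary-stack pushdown compressors: stack alphabet `{0, z₀}`. -/
abbrev UnaryPushdownCompressor : Type 1 := PDC Unit

/-- PD-depth of `S` is at least `α`. -/
def PDDepthGE (S : BitSeq) (α : ℝ) : Prop :=
  ∀ C : UnaryPushdownCompressor, C.IsLossless →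
    ∃ C' : PushdownCompressor, C'.IsLossless ∧ ∀ᶠ n : ℕ in atTop,
      ((C.output (seqPrefix S n)).length : ℝ) - ((C'.output (seqPrefix S n)).length : ℝ) ≥ α * n

end PebbleDepth

namespace PebbleDepth

/-! ## Counting strings -/

/-- The strings of length less than `N`. -/
def shortStrs : ℕ → Finset Str
  | 0 => ∅
  | N + 1 => insert [] ((shortStrs N).image (List.cons true) ∪ (shortStrs N).image (List.cons false))

theorem mem_shortStrs {N : ℕ} {x : Str} : x ∈ shortStrs N ↔ x.length < N := by
  induction N generalizing x with
  | zero => simp [shortStrs]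
  | succ N ih =>
    rcases x with _ | ⟨b, x⟩
    · simp [shortStrs]
    · cases b <;> simp [shortStrs, ih]

theorem card_shortStrs_lt (N : ℕ) : (shortStrs N).card < 2 ^ N := by
  induction N with
  | zero => simp [shortStrs]
  | succ N ih =>
    have h1 := Finset.card_insert_le ([] : Str)
      ((shortStrs N).image (List.cons true) ∪ (shortStrs N).image (List.cons false))
    have h2 := Finset.card_union_le ((shortStrs N).image (List.cons true))
      ((shortStrs N).image (List.cons false))
    have h3 : ((shortStrs N).image (List.cons true)).card ≤ _ := Finset.card_image_le
    have h4 : ((shortStrs N).image (List.cons false)).card ≤ _ := Finset.card_image_le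
    rw [shortStrs, pow_succ]
    omega

/-- Fewer than `2 ^ N` strings have Kolmogorov complexity less than `N`. -/
theorem finite_kolmogorov_lt {U : Str →. Str} (hU : IsUniversal U) (N : ℕ) :
    {x | kolmogorov U x < N}.Finite ∧ {x | kolmogorov U x < N}.ncard < 2 ^ N := by
  have hmin (x : Str) : ∃ y : Str, x ∈ U y ∧ y.length = kolmogorov U x := by
    have hne : {m : ℕ | ∃ y : Str, x ∈ U y ∧ y.length = m}.Nonempty := by
      obtain ⟨c, hc⟩ := hU.optimal (fun y => Part.some y) (Computable.id.partrec)
      obtain ⟨z, -, hz⟩ := hc x x (Part.mem_some x)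
      exact ⟨_, z, hz, rfl⟩
    exact Nat.sInf_mem hne
  choose f hf hlen using hmin
  have hinj : Function.Injective f := fun a b hab => Part.mem_unique (hf a) (hab ▸ hf b)
  have hmaps : ∀ x ∈ {x | kolmogorov U x < N}, f x ∈ (shortStrs N : Set Str) := fun x hx => by
    simpa [mem_shortStrs, hlen] using hx
  have hfin : {x | kolmogorov U x < N}.Finite :=
    Set.Finite.of_injOn hmaps hinj.injOn (Finset.finite_toSet _)
  refine ⟨hfin, lt_of_le_of_lt ?_ (card_shortStrs_lt N)⟩
  rw [← Set.ncard_coe_finset]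
  exact Set.ncard_le_ncard_of_injOn f hmaps hinj.injOn (Finset.finite_toSet _)

/-- The strings of length `n` with prescribed bits at the positions in `Z`. -/
def prescribed (n : ℕ) (Z : Finset ℕ) (v : ℕ → Bool) : Finset Str :=
  (Fintype.piFinset fun i : Fin n => if (i : ℕ) ∈ Z then {v i} else Finset.univ).image List.ofFn

theorem le_card_prescribed (n : ℕ) (Z : Finset ℕ) (v : ℕ → Bool) :
    2 ^ (n - Z.card) ≤ (prescribed n Z v).card := by
  rw [prescribed, Finset.card_image_of_injective _ List.ofFn_injective, Fintype.card_piFinset]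
  have h : ∀ i : Fin n, (if (i : ℕ) ∈ Z then ({v i} : Finset Bool) else Finset.univ).card =
      if (i : ℕ) ∈ Z then 1 else 2 := fun i => by split_ifs <;> simp
  simp only [h]
  rw [Finset.prod_ite, Finset.prod_const_one, one_mul, Finset.prod_const]
  apply Nat.pow_le_pow_right (by norm_num)
  have h1 : (Finset.univ.filter fun i : Fin n => (i : ℕ) ∈ Z).card ≤ Z.card :=
    Finset.card_le_card_of_injOn (fun i : Fin n => (i : ℕ)) (fun i hi => by simpa using hi)
      (Fin.val_injective.injOn)
  have h2 := Finset.card_filter_add_card_filter_not (s := (Finset.univ : Finset (Fin n)))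
    (fun i : Fin n => (i : ℕ) ∈ Z)
  simp only [Finset.card_univ, Fintype.card_fin] at h2
  omega

theorem mem_prescribed {n : ℕ} {Z : Finset ℕ} {v : ℕ → Bool} {x : Str}
    (hx : x ∈ prescribed n Z v) :
    x.length = n ∧ ∀ i ∈ Z, i < n → x[i]? = some (v i) := by
  simp only [prescribed, Finset.mem_image, Fintype.mem_piFinset] at hx
  obtain ⟨f, hf, rfl⟩ := hx
  refine ⟨by simp, fun i hi hin => ?_⟩
  have := hf ⟨i, hin⟩
  simp only [hi, if_true, Finset.mem_singleton] at this
  simp [hin, this]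

theorem not_replicate_infix {k : ℕ} {x : Str}
    (h : ∀ p, p + k ≤ x.length → ∃ i, p ≤ i ∧ i < p + k ∧ x[i]? = some false) :
    ¬ List.replicate k true <:+: x := by
  rintro ⟨s, t, rfl⟩
  obtain ⟨i, h1, h2, h3⟩ := h s.length (by simp)
  rw [List.append_assoc, List.getElem?_append_right h1,
    List.getElem?_append_left (by simp; omega)] at h3
  simp [List.getElem?_replicate] at h3

/-- The strings of length `k * u` that end with `0` and do not contain `1 ^ k`. -/
def candidates (k u : ℕ) : Set Str :=
  {x | x.length = k * u ∧ ¬ List.replicate k true <:+: x ∧ ∃ z, x = z ++ [false]}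

theorem finite_candidates (k u : ℕ) : (candidates k u).Finite :=
  (Finset.finite_toSet (shortStrs (k * u + 1))).subset fun x hx => by
    simp [mem_shortStrs, hx.1]

theorem exists_append_of_getElem? {n : ℕ} {x : Str} (hx : x.length = n + 1)
    (h : x[n]? = some false) : ∃ z, x = z ++ [false] := by
  rcases List.eq_nil_or_concat x with rfl | ⟨z, b, rfl⟩
  · simp at hx
  · simp at hx
    subst hx
    simp at h
    exact ⟨z, by simp [h]⟩

/-- The last positions of the `u` groups of `k` consecutive positions. -/
def lastPositions (k u : ℕ) : Finset ℕ := (Finset.range u).image fun t => t * k + (k - 1)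

theorem prescribed_false_subset_candidates {k u : ℕ} (hk : 0 < k) (hu : 0 < u) :
    (prescribed (k * u) (lastPositions k u) fun _ => false : Set Str) ⊆ candidates k u := by
  intro x hx
  obtain ⟨hlen, hx⟩ := mem_prescribed hx
  have key : ∀ t < u, x[t * k + (k - 1)]? = some false := fun t ht =>
    hx _ (Finset.mem_image.2 ⟨t, by simpa using ht, rfl⟩) (by
      have : (t + 1) * k ≤ u * k := Nat.mul_le_mul_right _ ht
      rw [Nat.mul_comm k u]; rw [Nat.succ_mul] at this; omega)
  refine ⟨hlen, not_replicate_infix fun p hp => ?_, ?_⟩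
  · have h1 := Nat.div_add_mod p k
    have h2 := Nat.mod_lt p hk
    rw [Nat.mul_comm] at h1
    refine ⟨p / k * k + (k - 1), by omega, by omega, key _ ?_⟩
    rw [Nat.div_lt_iff_lt_mul hk, Nat.mul_comm]
    omega
  · obtain ⟨u, rfl⟩ := Nat.exists_eq_add_of_lt hu
    simp only [Nat.zero_add] at *
    refine exists_append_of_getElem? (n := u * k + (k - 1)) ?_ (key u (by omega))
    rw [hlen, Nat.mul_succ, Nat.mul_comm]; omega

theorem prescribed_insert_subset_candidates {k u : ℕ} (hk : 2 < k) (hu : 1 < u) :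
    (prescribed (k * u) (insert 0 (insert k (lastPositions k u))) fun i => decide (i = k - 1) :
      Set Str) ⊆ candidates k u := by
  intro x hx
  obtain ⟨hlen, hx⟩ := mem_prescribed hx
  have hku : k * 2 ≤ k * u := Nat.mul_le_mul_left _ hu
  have key : ∀ t < u, t ≠ 0 → x[t * k + (k - 1)]? = some false := fun t ht h0 => by
    have h1 : k ≤ t * k := Nat.le_mul_of_pos_left _ (Nat.pos_of_ne_zero h0)
    rw [hx _ (by simp only [Finset.mem_insert]; right; right
                 exact Finset.mem_image.2 ⟨t, by simpa using ht, rfl⟩) (by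
      have : (t + 1) * k ≤ u * k := Nat.mul_le_mul_right _ ht
      rw [Nat.mul_comm k u]; rw [Nat.succ_mul] at this; omega)]
    simp; omega
  have key0 : x[0]? = some false := by
    rw [hx 0 (by simp) (by omega)]; simp; omega
  have keyk : x[k]? = some false := by
    rw [hx k (by simp) (by omega)]; simp; omega
  refine ⟨hlen, not_replicate_infix fun p hp => ?_, ?_⟩
  · rcases Nat.eq_zero_or_pos p with rfl | hp0
    · exact ⟨0, le_rfl, by omega, key0⟩
    rcases le_or_gt p k with hpk | hpk
    · exact ⟨k, hpk, by omega, keyk⟩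
    have h1 := Nat.div_add_mod p k
    have h2 := Nat.mod_lt p (show 0 < k by omega)
    have h3 : 0 < p / k := Nat.div_pos hpk.le (by omega)
    rw [Nat.mul_comm] at h1
    refine ⟨p / k * k + (k - 1), by omega, by omega, key _ ?_ h3.ne'⟩
    rw [Nat.div_lt_iff_lt_mul (by omega), Nat.mul_comm]
    omega
  · obtain ⟨u, rfl⟩ := Nat.exists_eq_add_of_lt hu
    refine exists_append_of_getElem? (n := (1 + u) * k + (k - 1)) ?_
      (key (1 + u) (by omega) (by omega))
    rw [hlen, Nat.mul_succ, Nat.mul_comm]; omega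

theorem card_lastPositions_le (k u : ℕ) : (lastPositions k u).card ≤ u :=
  Finset.card_image_le.trans (by simp)

theorem le_ncard_candidates {k u : ℕ} (hk : 0 < k) (hu : 0 < u) :
    2 ^ ((k - 1) * u) ≤ (candidates k u).ncard := by
  have h1 := Set.ncard_le_ncard (prescribed_false_subset_candidates hk hu) (finite_candidates k u)
  rw [Set.ncard_coe_finset] at h1
  refine le_trans ?_ ((le_card_prescribed _ _ _).trans h1)
  apply Nat.pow_le_pow_right (by norm_num)
  have := card_lastPositions_le k u
  rw [Nat.sub_mul, Nat.one_mul]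
  omega

theorem le_four_mul_ncard_candidates {k u : ℕ} (hk : 2 < k) (hu : 1 < u) :
    5 * 2 ^ ((k - 1) * u) ≤ 4 * (candidates k u).ncard := by
  have h0 : Disjoint (prescribed (k * u) (lastPositions k u) fun _ => false)
      (prescribed (k * u) (insert 0 (insert k (lastPositions k u))) fun i => decide (i = k - 1)) := by
    rw [Finset.disjoint_left]
    intro x hx hx'
    have hm : k - 1 ∈ lastPositions k u := Finset.mem_image.2 ⟨0, by simp; omega, by simp⟩
    have hku : k * 2 ≤ k * u := Nat.mul_le_mul_left _ hu
    have e1 := (mem_prescribed hx).2 (k - 1) hm (by omega)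
    have e2 := (mem_prescribed hx').2 (k - 1) (by simp [hm]) (by omega)
    rw [e1] at e2
    simp at e2
  have h1 := Set.ncard_le_ncard (Set.union_subset (prescribed_false_subset_candidates
    (show 0 < k by omega) (show 0 < u by omega)) (prescribed_insert_subset_candidates hk hu))
    (finite_candidates k u)
  rw [← Finset.coe_union, Set.ncard_coe_finset, Finset.card_union_of_disjoint h0] at h1
  have h2 := le_card_prescribed (k * u) (lastPositions k u) fun _ => false
  have h3 := le_card_prescribed (k * u) (insert 0 (insert k (lastPositions k u)))
    fun i => decide (i = k - 1)
  have h4 := card_lastPositions_le k u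
  have h5 := Finset.card_insert_le 0 (insert k (lastPositions k u))
  have h6 := Finset.card_insert_le k (lastPositions k u)
  have h7 : k * u = (k - 1) * u + u := by
    obtain ⟨k, rfl⟩ := Nat.exists_eq_add_of_lt hk
    simp; ring
  have h8 : 2 * 2 ≤ (k - 1) * u := Nat.mul_le_mul (by omega) hu
  have h9 : 2 ^ ((k - 1) * u) ≤ 2 ^ (k * u - (lastPositions k u).card) :=
    Nat.pow_le_pow_right (by norm_num) (by omega)
  have h10 : 2 ^ ((k - 1) * u - 2) ≤
      2 ^ (k * u - (insert 0 (insert k (lastPositions k u))).card) :=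
    Nat.pow_le_pow_right (by norm_num) (by omega)
  have h11 : 2 ^ ((k - 1) * u) = 4 * 2 ^ ((k - 1) * u - 2) := by
    rw [show (4 : ℕ) = 2 ^ 2 by norm_num, ← pow_add]; congr 1; omega
  omega

/-- For countably many families of small sets of strings there are strings of high Kolmogorov
complexity that eventually avoid each of the families. -/
theorem exists_avoiding {U : Str →. Str} (hU : IsUniversal U) {k : ℕ} (hk : 2 < k)
    {F : Set (ℕ → Set Str)} (hF : F.Countable)
    (hsmall : ∀ B ∈ F, ∀ᶠ u in atTop,
      (B u).Finite ∧ 4 * (u * (B u).ncard) ≤ 2 ^ ((k - 1) * u)) :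
    ∃ R : ℕ → Str, (∀ u, 0 < u → R u ∈ candidates k u ∧ (k - 1) * u ≤ kolmogorov U (R u)) ∧
      ∀ B ∈ F, ∀ᶠ u in atTop, R u ∉ B u := by
  rcases F.eq_empty_or_nonempty with rfl | hne
  · have : ∀ u, ∃ x, 0 < u → x ∈ candidates k u ∧ (k - 1) * u ≤ kolmogorov U x := fun u => by
      rcases Nat.eq_zero_or_pos u with rfl | hu
      · exact ⟨[], by simp⟩
      obtain ⟨hf, hc⟩ := finite_kolmogorov_lt hU ((k - 1) * u)
      obtain ⟨x, hx, hx'⟩ := Set.exists_mem_notMem_of_ncard_lt_ncard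
        (hc.trans_le (le_ncard_candidates (show 0 < k by omega) hu)) hf
      exact ⟨x, fun _ => ⟨hx, by simpa using hx'⟩⟩
    choose R hR using this
    exact ⟨R, hR, by simp⟩
  obtain ⟨B, rfl⟩ := hF.exists_eq_range hne
  have hsmall' : ∀ i, ∀ᶠ u in atTop,
      (B i u).Finite ∧ 4 * (u * (B i u).ncard) ≤ 2 ^ ((k - 1) * u) :=
    fun i => hsmall _ ⟨i, rfl⟩
  classical
  let I (u : ℕ) : Finset ℕ := (Finset.range u).filter fun i => 1 < u ∧
    (B i u).Finite ∧ 4 * (u * (B i u).ncard) ≤ 2 ^ ((k - 1) * u)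
  have : ∀ u, ∃ x, 0 < u → (x ∈ candidates k u ∧ (k - 1) * u ≤ kolmogorov U x) ∧
      ∀ i ∈ I u, x ∉ B i u := fun u => by
    rcases Nat.eq_zero_or_pos u with rfl | hu
    · exact ⟨[], by simp⟩
    obtain ⟨hf, hc⟩ := finite_kolmogorov_lt hU ((k - 1) * u)
    have hfin : (⋃ i ∈ I u, B i u).Finite :=
      Set.Finite.biUnion (Finset.finite_toSet _) fun i hi => (Finset.mem_filter.1 hi).2.2.1
    have hlt : ({x | kolmogorov U x < (k - 1) * u} ∪ ⋃ i ∈ I u, B i u).ncard <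
        (candidates k u).ncard := by
      refine lt_of_le_of_lt (Set.ncard_union_le _ _) ?_
      rcases le_or_gt u 1 with h1 | h1
      · have : I u = ∅ := Finset.filter_eq_empty_iff.2 fun i _ h => by omega
        simp only [this, Finset.notMem_empty, Set.iUnion_of_empty, Set.iUnion_empty,
          Set.ncard_empty, add_zero]
        exact hc.trans_le (le_ncard_candidates (show 0 < k by omega) hu)
      have h2 : (⋃ i ∈ I u, B i u).ncard ≤ ∑ i ∈ I u, (B i u).ncard :=
        Finset.set_ncard_biUnion_le _ _
      have h3 : ∑ i ∈ I u, 4 * (u * (B i u).ncard) ≤ ∑ i ∈ I u, 2 ^ ((k - 1) * u) :=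
        Finset.sum_le_sum fun i hi => (Finset.mem_filter.1 hi).2.2.2
      have h4 : (I u).card ≤ u := (Finset.card_filter_le _ _).trans (by simp)
      rw [Finset.sum_const, smul_eq_mul, ← Finset.mul_sum, ← Finset.mul_sum] at h3
      have h5 : u * (4 * ∑ i ∈ I u, (B i u).ncard) ≤ u * 2 ^ ((k - 1) * u) :=
        calc _ = 4 * (u * ∑ i ∈ I u, (B i u).ncard) := by ring
          _ ≤ _ := h3.trans (Nat.mul_le_mul_right _ h4)
      have h6 := Nat.le_of_mul_le_mul_left h5 hu
      have h7 := le_four_mul_ncard_candidates hk h1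
      omega
    obtain ⟨x, hx, hx'⟩ := Set.exists_mem_notMem_of_ncard_lt_ncard hlt (hf.union hfin)
    simp only [Set.mem_union, Set.mem_ofPred_eq, Set.mem_iUnion, not_or, not_exists, not_lt] at hx'
    exact ⟨x, fun _ => ⟨⟨hx, hx'.1⟩, hx'.2⟩⟩
  choose R hR using this
  refine ⟨R, fun u hu => (hR u hu).1, ?_⟩
  rintro _ ⟨i, rfl⟩
  filter_upwards [hsmall' i, eventually_gt_atTop i, eventually_gt_atTop 1] with u h1 h2 h3
  exact (hR u (by omega)).2 i (Finset.mem_filter.2 ⟨by simpa using h2, h3, h1⟩)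

/-- `B u` has at most polynomially many times `2 ^ ((k - 2) * u)` elements. -/
def IsSmall (k : ℕ) (B : ℕ → Set Str) : Prop :=
  ∃ c d : ℕ, ∀ u, 0 < u → (B u).Finite ∧ (B u).ncard ≤ c * u ^ d * 2 ^ ((k - 2) * u)

theorem eventually_poly_le_two_pow (c d : ℕ) : ∀ᶠ u : ℕ in atTop, c * u ^ d ≤ 2 ^ u := by
  have h := tendsto_pow_const_div_const_pow_of_one_lt d (r := (2 : ℝ)) (by norm_num)
  have h2 : (0 : ℝ) < 1 / (c + 1) := by positivity
  filter_upwards [h.eventually (gt_mem_nhds h2)] with u hu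
  rw [div_lt_div_iff₀ (by positivity) (by positivity)] at hu
  have : ((c * u ^ d : ℕ) : ℝ) ≤ ((2 ^ u : ℕ) : ℝ) := by
    push_cast
    nlinarith [pow_nonneg (Nat.cast_nonneg (α := ℝ) u) d]
  exact_mod_cast this

theorem IsSmall.eventually {k : ℕ} (hk : 2 < k) {B : ℕ → Set Str} (hB : IsSmall k B) :
    ∀ᶠ u in atTop, (B u).Finite ∧ 4 * (u * (B u).ncard) ≤ 2 ^ ((k - 1) * u) := by
  obtain ⟨c, d, h⟩ := hB
  filter_upwards [eventually_gt_atTop 0, eventually_poly_le_two_pow (4 * c) (d + 1)] with u hu h2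
  refine ⟨(h u hu).1, ?_⟩
  have e : (k - 1) * u = (k - 2) * u + u := by
    obtain ⟨k, rfl⟩ := Nat.exists_eq_add_of_lt hk
    simp [show 2 + k + 1 - 1 = k + 2 by omega, show 2 + k + 1 - 2 = k + 1 by omega]; ring
  calc 4 * (u * (B u).ncard) ≤ 4 * (u * (c * u ^ d * 2 ^ ((k - 2) * u))) := by
        gcongr; exact (h u hu).2
    _ = 4 * c * u ^ (d + 1) * 2 ^ ((k - 2) * u) := by ring
    _ ≤ 2 ^ u * 2 ^ ((k - 2) * u) := by gcongr
    _ = 2 ^ ((k - 1) * u) := by rw [e, pow_add, mul_comm]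

/-- The strings that are in `B` or have their reverse in `B`. -/
def withReverse (B : ℕ → Set Str) (u : ℕ) : Set Str := B u ∪ List.reverse '' B u

theorem IsSmall.withReverse {k : ℕ} {B : ℕ → Set Str} (hB : IsSmall k B) :
    IsSmall k (withReverse B) := by
  obtain ⟨c, d, h⟩ := hB
  refine ⟨2 * c, d, fun u hu => ⟨(h u hu).1.union ((h u hu).1.image _), ?_⟩⟩
  have h1 := Set.ncard_union_le (B u) (List.reverse '' B u)
  have h2 := Set.ncard_image_le (f := List.reverse) (h u hu).1
  have h3 := (h u hu).2
  have h4 : 2 * c * u ^ d * 2 ^ ((k - 2) * u) = 2 * (c * u ^ d * 2 ^ ((k - 2) * u)) := by ring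
  rw [PebbleDepth.withReverse, h4]
  omega

/-! ## Finite-state transducers do not compress incompressible strings -/

instance : Countable FST := by
  let e : FST → Σ n : ℕ, Fin n × (Fin n → Bool → Fin n) × (Fin n → Bool → Str) :=
    fun T => ⟨T.numStates, T.start, T.δ, T.ν⟩
  refine Function.Injective.countable (f := e) ?_
  rintro ⟨n, a, b, c⟩ ⟨n', a', b', c'⟩ h
  simp only [e, Sigma.mk.injEq] at h
  obtain ⟨rfl, h⟩ := h
  simp only [heq_eq_eq, Prod.mk.injEq] at h
  obtain ⟨rfl, rfl, rfl⟩ := h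
  rfl

theorem FST.exists_outputFrom_append (T : FST) (q : Fin T.numStates) (x : Str) :
    ∃ q', ∀ y, T.outputFrom q (x ++ y) = T.outputFrom q x ++ T.outputFrom q' y := by
  induction x generalizing q with
  | nil => exact ⟨q, fun y => rfl⟩
  | cons b x ih =>
    obtain ⟨q', h⟩ := ih (T.δ q b)
    exact ⟨q', fun y => by simp [outputFrom, h]⟩

theorem FST.exists_length_outputFrom_le (T : FST) :
    ∃ M, ∀ q x, (T.outputFrom q x).length ≤ M * x.length := by
  obtain ⟨M, hM⟩ := (Set.finite_range fun p : Fin T.numStates × Bool =>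
    (T.ν p.1 p.2).length).bddAbove
  refine ⟨M, fun q x => ?_⟩
  induction x generalizing q with
  | nil => simp [outputFrom]
  | cons b x ih =>
    have h1 : (T.ν q b).length ≤ M := hM ⟨(q, b), rfl⟩
    have h2 := ih (T.δ q b)
    simp only [outputFrom, List.length_append, List.length_cons, Nat.mul_succ]
    omega

/-- The strings of length `k * u` that `T` produces from at most `(k - 2) * u` symbols. -/
def FST.compressible (T : FST) (k u : ℕ) : Set Str :=
  {w | w.length = k * u ∧ ∃ q y, y.length ≤ (k - 2) * u ∧ w <:+: T.outputFrom q y}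

theorem FST.isSmall_compressible (T : FST) (k : ℕ) : IsSmall k (T.compressible k) := by
  obtain ⟨M, hM⟩ := T.exists_length_outputFrom_le
  refine ⟨2 * T.numStates * (M * k + 1), 1, fun u hu => ?_⟩
  let A : Finset (Fin T.numStates × Str × ℕ) :=
    Finset.univ ×ˢ shortStrs ((k - 2) * u + 1) ×ˢ Finset.range (M * ((k - 2) * u) + 1)
  have hsub : T.compressible k u ⊆
      (A.image fun p => ((T.outputFrom p.1 p.2.1).drop p.2.2).take (k * u) : Finset Str) := by
    rintro w ⟨hw, q, y, hy, s, t, hst⟩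
    simp only [Finset.coe_image, Set.mem_image, SetLike.mem_coe]
    refine ⟨(q, y, s.length), ?_, ?_⟩
    · simp only [A, Finset.mem_product, Finset.mem_univ, true_and, mem_shortStrs,
        Finset.mem_range]
      have h1 := hM q y
      have h2 : M * y.length ≤ M * ((k - 2) * u) := Nat.mul_le_mul_left _ hy
      have h3 := congrArg List.length hst
      simp only [List.length_append] at h3
      omega
    · simp only [← hst, List.append_assoc, List.drop_left]
      rw [← hw, List.take_left]
  refine ⟨(Finset.finite_toSet _).subset hsub, ?_⟩
  have h1 := Set.ncard_le_ncard hsub (Finset.finite_toSet _)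
  rw [Set.ncard_coe_finset] at h1
  have h2 := (card_shortStrs_lt ((k - 2) * u + 1)).le
  calc _ ≤ A.card := h1.trans Finset.card_image_le
    _ = T.numStates * ((shortStrs ((k - 2) * u + 1)).card * (M * ((k - 2) * u) + 1)) := by
      simp [A, Finset.card_product]
    _ ≤ T.numStates * (2 ^ ((k - 2) * u + 1) * ((M * k + 1) * u)) := by
      gcongr
      rw [Nat.add_mul, one_mul, mul_assoc]
      gcongr
      · omega
      · exact hu
    _ = _ := by rw [pow_succ]; ring

/-- How much of the input `y` the transducer can read without writing more than `p` symbols. -/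
def FST.progress (T : FST) (y : Str) (p : ℕ) : ℕ :=
  Nat.findGreatest (fun t => (T.output (y.take t)).length ≤ p) y.length

theorem FST.monotone_progress (T : FST) (y : Str) : Monotone (T.progress y) := fun _ _ h =>
  Nat.findGreatest_mono_left (fun _ hn => le_trans hn h) _

theorem FST.progress_le (T : FST) (y : Str) (p : ℕ) : T.progress y p ≤ y.length :=
  Nat.findGreatest_le _

theorem infix_of_append_eq {X Y Z a w b : Str} (h : X ++ (Y ++ Z) = a ++ (w ++ b))
    (h1 : X.length ≤ a.length) (h2 : a.length + w.length ≤ X.length + Y.length) : w <:+: Y := by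
  obtain ⟨c, rfl⟩ : X <+: a :=
    List.prefix_of_prefix_length_le (h ▸ List.prefix_append _ _) (List.prefix_append _ _) h1
  rw [List.append_assoc, List.append_cancel_left_eq, ← List.append_assoc] at h
  simp only [List.length_append] at h2
  obtain ⟨d, rfl⟩ : c ++ w <+: Y :=
    List.prefix_of_prefix_length_le (l₃ := Y ++ Z) (h ▸ List.prefix_append _ _)
      (List.prefix_append _ _) (by simp; omega)
  exact ⟨c, d, rfl⟩

theorem FST.le_progress (T : FST) {k u : ℕ} {y a w b : Str} (h : T.output y = a ++ (w ++ b))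
    (hw : w.length = k * u) (hT : w ∉ T.compressible k u) :
    T.progress y a.length + (k - 2) * u ≤ T.progress y (a.length + w.length) := by
  set s := T.progress y a.length with hs
  set e := T.progress y (a.length + w.length) with he
  have hs1 : (T.output (y.take s)).length ≤ a.length :=
    Nat.findGreatest_spec (P := fun t => (T.output (y.take t)).length ≤ a.length)
      (Nat.zero_le _) (by simp [output, outputFrom])
  have hsy : s ≤ y.length := T.progress_le y _
  have hey : e ≤ y.length := T.progress_le y _
  have hse : s ≤ e := T.monotone_progress y (Nat.le_add_right _ _)
  have ht : ∃ t, s ≤ t ∧ t ≤ e + 1 ∧ t ≤ y.length ∧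
      a.length + w.length ≤ (T.output (y.take t)).length := by
    rcases hey.eq_or_lt with h1 | h1
    · refine ⟨e, hse, by omega, hey, ?_⟩
      rw [h1, List.take_length, h]
      simp only [List.length_append]
      omega
    · refine ⟨e + 1, by omega, le_rfl, h1, ?_⟩
      have := Nat.findGreatest_is_greatest
        (P := fun t => (T.output (y.take t)).length ≤ a.length + w.length)
        (show e < e + 1 by omega) h1
      omega
  obtain ⟨t, h1, h2, h3, h4⟩ := ht
  obtain ⟨q, hq⟩ := T.exists_outputFrom_append T.start (y.take s)
  obtain ⟨q', hq'⟩ := T.exists_outputFrom_append T.start (y.take t)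
  have e1 : y.take t = y.take s ++ (y.take t).drop s := by
    conv_lhs => rw [← List.take_append_drop s (y.take t), List.take_take, min_eq_left h1]
  have e2 : T.output (y.take t) = T.output (y.take s) ++ T.outputFrom q ((y.take t).drop s) := by
    conv_lhs => rw [e1]
    exact hq _
  have e3 : T.output y = T.output (y.take t) ++ T.outputFrom q' (y.drop t) := by
    conv_lhs => rw [← List.take_append_drop t y]
    exact hq' _
  rw [e3, e2, List.append_assoc] at h
  have hinf := infix_of_append_eq h hs1 (by rw [e2, List.length_append] at h4; exact h4)
  have hlen : ((y.take t).drop s).length = t - s := by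
    rw [List.length_drop, List.length_take, min_eq_left h3]
  by_contra hlt
  exact hT ⟨hw, q, _, by rw [hlen]; omega, hinf⟩

/-! ## Runs of pushdown compressors -/

namespace PDCData

variable {A : Type}

/-- Read `x` from the configuration `y`, performing all possible `λ`-transitions after each
bit. -/
def runFrom (C : PDCData A) (y : C.Config) (x : Str) : Option C.Config :=
  x.foldl (fun o b => o.bind fun y => (C.step (some b) y).map (C.lambdaRun C.c)) (some y)

/-- Read `x` from the initial configuration. -/
def run (C : PDCData A) (x : Str) : Option C.Config :=
  C.runFrom (C.lambdaRun C.c { state := C.start, stack := [none], out := [] }) x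

theorem foldl_bind (C : PDCData A) (x : Str) (o : Option C.Config) :
    x.foldl (fun o b => o.bind fun y => (C.step (some b) y).map (C.lambdaRun C.c)) o =
      o.bind fun y => C.runFrom y x := by
  cases o with
  | some y => rfl
  | none =>
    induction x with
    | nil => rfl
    | cons b x ih => simpa using ih

@[simp] theorem runFrom_nil (C : PDCData A) (y : C.Config) : C.runFrom y [] = some y := rfl

theorem runFrom_cons (C : PDCData A) (y : C.Config) (b : Bool) (x : Str) :
    C.runFrom y (b :: x) =
      ((C.step (some b) y).map (C.lambdaRun C.c)).bind fun z => C.runFrom z x := by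
  rw [← foldl_bind]; rfl

theorem runFrom_append (C : PDCData A) (y : C.Config) (x z : Str) :
    C.runFrom y (x ++ z) = (C.runFrom y x).bind fun y => C.runFrom y z := by
  rw [← foldl_bind]; simp [runFrom]

theorem run_append (C : PDCData A) (x z : Str) :
    C.run (x ++ z) = (C.run x).bind fun y => C.runFrom y z := C.runFrom_append _ x z

theorem lambdaRun_induction (C : PDCData A) {p : C.Config → Prop}
    (hp : ∀ y z, C.step none y = some z → p y → p z) (m : ℕ) {y : C.Config} (hy : p y) :
    p (C.lambdaRun m y) := by
  induction m generalizing y with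
  | zero => exact hy
  | succ m ih =>
    rw [lambdaRun]
    split
    · exact hy
    · next z hz => exact ih (hp _ _ hz hy)

theorem runFrom_induction (C : PDCData A) {p : C.Config → Prop}
    (hp : ∀ b y z, C.step b y = some z → p y → p z) {x : Str} {y z : C.Config}
    (h : C.runFrom y x = some z) (hy : p y) : p z := by
  induction x generalizing y with
  | nil => simp only [runFrom_nil, Option.some.injEq] at h; exact h ▸ hy
  | cons b x ih =>
    rw [runFrom_cons] at h
    cases h1 : C.step (some b) y with
    | none => simp [h1] at h
    | some w =>
      simp only [h1, Option.map_some, Option.bind_some] at h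
      exact ih h (C.lambdaRun_induction (hp none) _ (hp _ _ _ h1 hy))

theorem step_eq_some {C : PDCData A} {b : Option Bool} {y z : C.Config}
    (h : C.step b y = some z) : ∃ a s r, y.stack = a :: s ∧ C.δ y.state b a = some r ∧
      z = { state := r.1, stack := r.2 ++ s, out := y.out ++ C.ν y.state b a } := by
  unfold step at h
  split at h
  · simp at h
  · next a s hs =>
    obtain ⟨r, hr, hz⟩ := Option.map_eq_some_iff.1 h
    exact ⟨a, s, r, hs, hr, hz.symm⟩

theorem out_prefix_of_runFrom (C : PDCData A) {x : Str} {y z : C.Config}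
    (h : C.runFrom y x = some z) : y.out <+: z.out :=
  C.runFrom_induction (p := fun z => y.out <+: z.out) (fun b y' z' h' hp => by
    obtain ⟨a, s, r, -, -, rfl⟩ := step_eq_some h'
    exact hp.trans (List.prefix_append _ _)) h (List.prefix_refl _)

/-- The strings of length `k * u` on which the output grows by at most `(k - 2) * u` symbols
from some reachable configuration with a stack of height at most `H u`. -/
def compressible (C : PDCData A) (k : ℕ) (H : ℕ → ℕ) (u : ℕ) : Set Str :=
  {w | w.length = k * u ∧ ∃ x y z, C.run x = some y ∧ C.runFrom y w = some z ∧
    y.stack.length ≤ H u ∧ z.out.length ≤ y.out.length + (k - 2) * u}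

/-! ### Renaming the states -/

/-- The compressor with its states renamed by `e`. -/
def rename (C : PDCData A) {Q : Type} [Finite Q] (e : C.State ≃ Q) : PDCData A where
  State := Q
  finite_state := inferInstance
  δ q b a := (C.δ (e.symm q) b a).map (Prod.map e id)
  ν q b a := C.ν (e.symm q) b a
  start := e C.start
  c := C.c

/-- The configuration with its state renamed by `e`. -/
def renameConfig (C : PDCData A) {Q : Type} [Finite Q] (e : C.State ≃ Q) (y : C.Config) :
    (C.rename e).Config :=
  { state := e y.state, stack := y.stack, out := y.out }

variable {Q : Type} [Finite Q]

theorem step_rename (C : PDCData A) (e : C.State ≃ Q) (b : Option Bool) (y : C.Config) :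
    (C.rename e).step b (C.renameConfig e y) = (C.step b y).map (C.renameConfig e) := by
  obtain ⟨q, s, o⟩ := y
  cases s with
  | nil => rfl
  | cons a s =>
    simp only [step, rename, renameConfig, Equiv.symm_apply_apply]
    cases C.δ q b a <;> rfl

theorem lambdaRun_rename (C : PDCData A) (e : C.State ≃ Q) (m : ℕ) (y : C.Config) :
    (C.rename e).lambdaRun m (C.renameConfig e y) = C.renameConfig e (C.lambdaRun m y) := by
  induction m generalizing y with
  | zero => rfl
  | succ m ih =>
    rw [lambdaRun, lambdaRun, step_rename]
    cases C.step none y with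
    | none => rfl
    | some z => exact ih z

theorem runFrom_rename (C : PDCData A) (e : C.State ≃ Q) (y : C.Config) (x : Str) :
    (C.rename e).runFrom (C.renameConfig e y) x = (C.runFrom y x).map (C.renameConfig e) := by
  induction x generalizing y with
  | nil => rfl
  | cons b x ih =>
    rw [runFrom_cons, runFrom_cons, step_rename]
    cases C.step (some b) y with
    | none => rfl
    | some z =>
      simp only [Option.map_some, Option.bind_some]
      rw [← ih, ← lambdaRun_rename]
      rfl

theorem run_rename (C : PDCData A) (e : C.State ≃ Q) (x : Str) :
    (C.rename e).run x = (C.run x).map (C.renameConfig e) := by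
  rw [run, run, ← runFrom_rename, ← lambdaRun_rename]
  rfl

theorem compressible_rename (C : PDCData A) (e : C.State ≃ Q) (k : ℕ) (H : ℕ → ℕ) :
    (C.rename e).compressible k H = C.compressible k H := by
  funext u
  ext w
  simp only [compressible, Set.mem_ofPred_eq, run_rename, Option.map_eq_some_iff]
  refine and_congr_right fun _ => exists_congr fun x => ⟨?_, ?_⟩
  · rintro ⟨_, z, ⟨y, hy, rfl⟩, h2, h3, h4⟩
    rw [runFrom_rename, Option.map_eq_some_iff] at h2
    obtain ⟨z, hz, rfl⟩ := h2
    exact ⟨y, z, hy, hz, h3, h4⟩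
  · rintro ⟨y, z, hy, hz, h3, h4⟩
    exact ⟨_, C.renameConfig e z, ⟨y, hy, rfl⟩, by rw [runFrom_rename, hz]; rfl, h3, h4⟩

/-- Data that determine a compressor whose states are the elements of some `Fin n`. -/
abbrev Code (A : Type) : Type :=
  Σ n : ℕ, (Fin n → Option Bool → Option A → Option (Fin n × List (Option A))) ×
    (Fin n → Option Bool → Option A → Str) × Fin n × ℕ

/-- The compressor determined by a code. -/
def ofCode (d : Code A) : PDCData A where
  State := Fin d.1
  finite_state := inferInstance
  δ := d.2.1
  ν := d.2.2.1
  start := d.2.2.2.1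
  c := d.2.2.2.2

theorem exists_rename_eq_ofCode (C : PDCData A) :
    ∃ (n : ℕ) (e : C.State ≃ Fin n) (d : Code A), C.rename e = ofCode d := by
  have := C.finite_state
  obtain ⟨n, ⟨e⟩⟩ := Finite.exists_equiv_fin C.State
  exact ⟨n, e, ⟨n, (C.rename e).δ, (C.rename e).ν, (C.rename e).start, C.c⟩, rfl⟩

end PDCData

/-! ## Unary pushdown compressors do not compress incompressible strings -/

namespace PDC

variable {A : Type}

theorem run_eq (C : PDC A) (x : Str) : C.run x = C.toPDCData.run x := rfl

theorem length_stack_lambdaRun_le (C : PDC A) (m : ℕ) (y : C.Config) :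
    (C.lambdaRun m y).stack.length ≤ y.stack.length :=
  C.lambdaRun_induction (p := fun z => z.stack.length ≤ y.stack.length) (fun y' z' h hp => by
    obtain ⟨a, s, r, h1, h2, rfl⟩ := PDCData.step_eq_some h
    rw [h1, List.length_cons] at hp
    simp only [C.lambda_pop _ _ _ _ h2, List.nil_append]
    omega) m le_rfl

theorem none_mem_of_step (C : PDC A) {b : Option Bool} {y z : C.Config}
    (h : C.step b y = some z) (hy : none ∈ y.stack) : none ∈ z.stack := by
  obtain ⟨a, s, r, h1, h2, rfl⟩ := PDCData.step_eq_some h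
  rw [h1, List.mem_cons] at hy
  simp only [List.mem_append]
  rcases hy with rfl | hy
  · obtain ⟨v, hv⟩ := C.keep_bottom _ _ _ _ h2
    simp [hv]
  · exact Or.inr hy

theorem none_mem_stack (C : PDC A) {x : Str} {y : C.Config} (h : C.toPDCData.run x = some y) :
    none ∈ y.stack :=
  C.runFrom_induction (p := fun y => none ∈ y.stack) (fun _ _ _ => C.none_mem_of_step) h
    (C.lambdaRun_induction (p := fun y => none ∈ y.stack) (fun _ _ => C.none_mem_of_step) _
      (by simp))

theorem exists_length_stack_le (C : PDC A) [Finite A] :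
    ∃ E, ∀ x y, C.toPDCData.run x = some y → y.stack.length ≤ E * x.length + 1 := by
  have := C.finite_state
  obtain ⟨E, hE⟩ := (Set.finite_range fun p : C.State × Option Bool × Option A =>
    ((C.δ p.1 p.2.1 p.2.2).elim 0 fun r => r.2.length)).bddAbove
  have key : ∀ x (y z : C.Config), C.runFrom y x = some z →
      z.stack.length ≤ E * x.length + y.stack.length := by
    intro x
    induction x with
    | nil => intro y z h; simp only [PDCData.runFrom_nil, Option.some.injEq] at h; simp [h]
    | cons b x ih =>
      intro y z h
      rw [PDCData.runFrom_cons] at h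
      cases h1 : C.step (some b) y with
      | none => simp [h1] at h
      | some w =>
        simp only [h1, Option.map_some, Option.bind_some] at h
        have h2 := ih _ _ h
        have h3 := C.length_stack_lambdaRun_le C.c w
        obtain ⟨a, s, r, h4, h5, rfl⟩ := PDCData.step_eq_some h1
        have h6 : r.2.length ≤ E := by
          have := hE ⟨(y.state, some b, a), rfl⟩
          simpa [h5] using this
        simp only [List.length_append] at h3
        simp only [h4, List.length_cons, Nat.mul_succ]
        omega
  refine ⟨E, fun x y h => (key x _ y h).trans ?_⟩
  have := C.length_stack_lambdaRun_le C.c { state := C.start, stack := [none], out := [] }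
  simp only [List.length_singleton] at this
  omega

/-- The configurations `y` and `z` agree, up to what is below some bottom symbol on the stack and
up to the outputs `o` and `o'` that have been written before. -/
def Agree (C : PDC A) (o o' : Str) (y z : C.Config) : Prop :=
  y.state = z.state ∧ (∃ s r r', y.stack = s ++ none :: r ∧ z.stack = s ++ none :: r') ∧
    ∃ w, y.out = o ++ w ∧ z.out = o' ++ w

theorem Agree.symm {C : PDC A} {o o' : Str} {y z : C.Config} (h : C.Agree o o' y z) :
    C.Agree o' o z y := by
  obtain ⟨h1, ⟨s, r, r', h2, h3⟩, w, h4, h5⟩ := h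
  exact ⟨h1.symm, ⟨s, r', r, h3, h2⟩, w, h5, h4⟩

theorem Agree.step {C : PDC A} {o o' : Str} {y z y' : C.Config} {b : Option Bool}
    (h : C.Agree o o' y z) (hy : C.step b y = some y') :
    ∃ z', C.step b z = some z' ∧ C.Agree o o' y' z' := by
  obtain ⟨q, s₁, o₁⟩ := y
  obtain ⟨q', s₂, o₂⟩ := z
  obtain ⟨h1, ⟨s, r, r', h2, h3⟩, w, h4, h5⟩ := h
  simp only at h1 h2 h3 h4 h5
  subst h1 h2 h3 h4 h5
  obtain ⟨a, t, d, ha, hd, rfl⟩ := PDCData.step_eq_some hy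
  simp only at ha hd
  cases s with
  | nil =>
    simp only [List.nil_append, List.cons.injEq] at ha
    obtain ⟨rfl, rfl⟩ := ha
    obtain ⟨v, hv⟩ := C.keep_bottom _ _ _ _ hd
    refine ⟨⟨d.1, d.2 ++ r', o' ++ w ++ C.ν q b none⟩, by simp [PDCData.step, hd], rfl,
      ⟨v, r, r', by simp [hv], by simp [hv]⟩, w ++ C.ν q b none, by simp, by simp⟩
  | cons a' s =>
    simp only [List.cons_append, List.cons.injEq] at ha
    obtain ⟨rfl, rfl⟩ := ha
    exact ⟨⟨d.1, d.2 ++ (s ++ none :: r'), o' ++ w ++ C.ν q b a'⟩, by simp [PDCData.step, hd], rfl,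
      ⟨d.2 ++ s, r, r', by simp, by simp⟩, w ++ C.ν q b a', by simp, by simp⟩

theorem Agree.lambdaRun {C : PDC A} {o o' : Str} {y z : C.Config} (h : C.Agree o o' y z)
    (m : ℕ) : C.Agree o o' (C.lambdaRun m y) (C.lambdaRun m z) := by
  induction m generalizing y z with
  | zero => exact h
  | succ m ih =>
    rw [PDCData.lambdaRun, PDCData.lambdaRun]
    cases hy : C.toPDCData.step none y with
    | some y' =>
      obtain ⟨z', hz, h'⟩ := h.step hy
      simp only [hz]
      exact ih h'
    | none =>
      cases hz : C.toPDCData.step none z with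
      | none => exact h
      | some z' =>
        obtain ⟨y', hy', -⟩ := h.symm.step hz
        simp [hy'] at hy

theorem Agree.runFrom {C : PDC A} {o o' : Str} {y z y' : C.Config} {x : Str}
    (h : C.Agree o o' y z) (hy : C.runFrom y x = some y') :
    ∃ z', C.runFrom z x = some z' ∧ C.Agree o o' y' z' := by
  induction x generalizing y z with
  | nil =>
    simp only [PDCData.runFrom_nil, Option.some.injEq] at hy
    exact ⟨z, rfl, hy ▸ h⟩
  | cons b x ih =>
    rw [PDCData.runFrom_cons] at hy
    cases h1 : C.toPDCData.step (some b) y with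
    | none => simp [h1] at hy
    | some w =>
      simp only [h1, Option.map_some, Option.bind_some] at hy
      obtain ⟨w', h2, h3⟩ := h.step h1
      obtain ⟨z', h4, h5⟩ := ih (h3.lambdaRun C.c) hy
      exact ⟨z', by rw [PDCData.runFrom_cons, h2]; exact h4, h5⟩

end PDC

theorem exists_replicate_append_none {s : List (Option Unit)} (h : none ∈ s) :
    ∃ n r, s = List.replicate n (some ()) ++ none :: r := by
  induction s with
  | nil => simp at h
  | cons a s ih =>
    rcases a with _ | ⟨⟩
    · exact ⟨0, s, rfl⟩
    · obtain ⟨n, r, rfl⟩ := ih (by simpa using h)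
      exact ⟨n + 1, r, rfl⟩

theorem UnaryPushdownCompressor.isSmall_compressible {C : UnaryPushdownCompressor}
    (hC : C.IsLossless) (k : ℕ) {H : ℕ → ℕ} {c d : ℕ} (hH : ∀ u, 0 < u → H u ≤ c * u ^ d) :
    IsSmall k (C.compressible k H) := by
  classical
  have := C.finite_state
  have := Fintype.ofFinite C.State
  have : Nonempty C.State := ⟨C.start⟩
  refine ⟨2 * Fintype.card C.State * Fintype.card C.State * c, d, fun u hu => ?_⟩
  have hex : ∀ w ∈ C.compressible k H u, ∃ p : C.State × ℕ × C.State × Str,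
      p ∈ (Finset.univ ×ˢ Finset.range (H u) ×ˢ Finset.univ ×ˢ shortStrs ((k - 2) * u + 1) :
        Finset _) ∧
      ∃ x y z r, C.run x = some y ∧ C.runFrom y w = some z ∧ y.state = p.1 ∧
        y.stack = List.replicate p.2.1 (some ()) ++ none :: r ∧ z.state = p.2.2.1 ∧
        z.out = y.out ++ p.2.2.2 := by
    rintro w ⟨-, x, y, z, hy, hz, h1, h2⟩
    obtain ⟨n, r, hn⟩ := exists_replicate_append_none (C.none_mem_stack hy)
    obtain ⟨o, ho⟩ := C.out_prefix_of_runFrom hz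
    refine ⟨(y.state, n, z.state, o), ?_, x, y, z, r, hy, hz, rfl, hn, rfl, ho.symm⟩
    simp only [Finset.mem_product, Finset.mem_univ, true_and, Finset.mem_range, mem_shortStrs]
    rw [hn] at h1
    rw [← ho] at h2
    simp only [List.length_append, List.length_replicate, List.length_cons] at h1 h2
    omega
  choose! f hf hf' using hex
  have hinj : Set.InjOn f (C.compressible k H u) := by
    intro w₁ h1 w₂ h2 he
    obtain ⟨x₁, y₁, z₁, r₁, hx₁, hw₁, a1, a2, a3, a4⟩ := hf' _ h1
    obtain ⟨x₂, y₂, z₂, r₂, hx₂, hw₂, b1, b2, b3, b4⟩ := hf' _ h2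
    rw [← he] at b1 b2 b3 b4
    have hag : C.Agree y₂.out y₁.out y₂ y₁ := ⟨by rw [a1, b1], ⟨_, _, _, b2, a2⟩, [], by simp⟩
    obtain ⟨z, hz, g1, -, o, g2, g3⟩ := hag.runFrom hw₂
    have ho : o = (f w₁).2.2.2 := by rw [b4] at g2; exact (List.append_cancel_left g2).symm
    have e1 : C.run (x₁ ++ w₁) = some z₁ := by
      rw [PDC.run_eq, PDCData.run_append, ← PDC.run_eq, hx₁]; exact hw₁
    have e2 : C.run (x₁ ++ w₂) = some z := by
      rw [PDC.run_eq, PDCData.run_append, ← PDC.run_eq, hx₁]; exact hz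
    refine List.append_cancel_left (hC.2 (a₁ := x₁ ++ w₁) (a₂ := x₁ ++ w₂) ?_)
    simp only [e1, e2, Option.map_some, a4, g3, ho, a3, ← g1, b3]
  have hmaps : Set.MapsTo f (C.compressible k H u)
      ((Finset.univ ×ˢ Finset.range (H u) ×ˢ Finset.univ ×ˢ shortStrs ((k - 2) * u + 1) :
        Finset (C.State × ℕ × C.State × Str)) : Set _) := fun w hw => hf w hw
  refine ⟨Set.Finite.of_injOn hmaps hinj (Finset.finite_toSet _), ?_⟩
  have h1 := Set.ncard_le_ncard_of_injOn f hmaps hinj (Finset.finite_toSet _)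
  rw [Set.ncard_coe_finset] at h1
  have h2 := (card_shortStrs_lt ((k - 2) * u + 1)).le
  calc _ ≤ _ := h1
    _ = Fintype.card C.State * (H u * (Fintype.card C.State *
          (shortStrs ((k - 2) * u + 1)).card)) := by simp [Finset.card_product]
    _ ≤ Fintype.card C.State * (c * u ^ d * (Fintype.card C.State *
          2 ^ ((k - 2) * u + 1))) := by
      gcongr
      exact hH u hu
    _ = _ := by rw [pow_succ]; ring

/-! ## Infinite concatenations -/

/-- The string `w` occurs in `S` at position `p`. -/
def Occurs (S : BitSeq) (p : ℕ) (w : Str) : Prop := ∀ i < w.length, w[i]? = some (S (p + i))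

@[simp] theorem length_seqPrefix (S : BitSeq) (n : ℕ) : (seqPrefix S n).length = n := by
  simp [seqPrefix]

theorem getElem?_seqPrefix {S : BitSeq} {n i : ℕ} (h : i < n) :
    (seqPrefix S n)[i]? = some (S i) := by
  simp [seqPrefix, h]

theorem occurs_append {S : BitSeq} {p : ℕ} {v w : Str} :
    Occurs S p (v ++ w) ↔ Occurs S p v ∧ Occurs S (p + v.length) w := by
  constructor
  · refine fun h => ⟨fun i hi => ?_, fun i hi => ?_⟩
    · rw [← h i (by simp; omega), List.getElem?_append_left hi]
    · rw [Nat.add_assoc, ← h (v.length + i) (by simp; omega),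
        List.getElem?_append_right (by omega), Nat.add_sub_cancel_left]
  · rintro ⟨h1, h2⟩ i hi
    rw [List.length_append] at hi
    rcases lt_or_ge i v.length with h | h
    · rw [List.getElem?_append_left h, h1 i h]
    · rw [List.getElem?_append_right h, h2 _ (by omega)]
      congr 2; omega

theorem seqPrefix_of_occurs_zero {S : BitSeq} {w : Str} (h : Occurs S 0 w) :
    seqPrefix S w.length = w := by
  apply List.ext_getElem?
  intro i
  rcases lt_or_ge i w.length with hi | hi
  · rw [getElem?_seqPrefix hi, h i hi, Nat.zero_add]
  · rw [List.getElem?_eq_none hi, List.getElem?_eq_none (by simpa using hi)]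

theorem occurs_zero_seqPrefix (S : BitSeq) (n : ℕ) : Occurs S 0 (seqPrefix S n) := fun i hi => by
  rw [length_seqPrefix] at hi
  rw [getElem?_seqPrefix hi, Nat.zero_add]

theorem Occurs.seqPrefix_add {S : BitSeq} {p : ℕ} {w : Str} (h : Occurs S p w) :
    seqPrefix S (p + w.length) = seqPrefix S p ++ w := by
  have := seqPrefix_of_occurs_zero (occurs_append.2 ⟨occurs_zero_seqPrefix S p, by simpa using h⟩)
  rwa [List.length_append, length_seqPrefix] at this

theorem exists_seqPrefix_eq_append (S : BitSeq) {m n : ℕ} (h : m ≤ n) :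
    ∃ t, seqPrefix S n = seqPrefix S m ++ t ∧ t.length = n - m := by
  have hm : (seqPrefix S n).take m = seqPrefix S m := by
    rw [seqPrefix, seqPrefix, ← List.map_take, List.take_range, min_eq_left h]
  refine ⟨(seqPrefix S n).drop m, ?_, by simp⟩
  conv_lhs => rw [← List.take_append_drop m (seqPrefix S n), hm]

/-- The concatenation of the blocks `B 1, …, B m`. -/
def blockPrefix (B : ℕ → Str) (m : ℕ) : Str := (List.range m).flatMap fun j => B (j + 1)

theorem blockPrefix_succ (B : ℕ → Str) (m : ℕ) :
    blockPrefix B (m + 1) = blockPrefix B m ++ B (m + 1) := by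
  simp [blockPrefix, List.range_succ]

theorem le_length_blockPrefix {B : ℕ → Str} (hB : ∀ j, 0 < (B (j + 1)).length) (m : ℕ) :
    m ≤ (blockPrefix B m).length := by
  induction m with
  | zero => simp
  | succ m ih =>
    rw [blockPrefix_succ, List.length_append]
    have := hB m
    omega

theorem blockPrefix_prefix (B : ℕ → Str) {m n : ℕ} (h : m ≤ n) :
    blockPrefix B m <+: blockPrefix B n := by
  induction n, h using Nat.le_induction with
  | base => exact List.prefix_refl _
  | succ n _ ih => exact ih.trans (blockPrefix_succ B n ▸ List.prefix_append _ _)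

theorem exists_occurs_blockPrefix {B : ℕ → Str} (hB : ∀ j, 0 < (B (j + 1)).length) :
    ∃ S : BitSeq, ∀ m, Occurs S 0 (blockPrefix B m) := by
  refine ⟨fun i => (blockPrefix B (i + 1))[i]?.getD false, fun m i hi => ?_⟩
  have h1 : i < (blockPrefix B (i + 1)).length := le_length_blockPrefix hB (i + 1)
  beta_reduce
  rw [Nat.zero_add, List.getElem?_eq_getElem h1, Option.getD_some, ← List.getElem?_eq_getElem h1]
  rcases le_total m (i + 1) with h | h
  · exact (List.prefix_iff_getElem?.1 (blockPrefix_prefix B h) i hi).symm ▸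
      List.getElem?_eq_getElem hi
  · rw [List.prefix_iff_getElem?.1 (blockPrefix_prefix B h) i h1, List.getElem?_eq_getElem h1]

@[simp] theorem length_strPow (x : Str) (n : ℕ) : (strPow x n).length = n * x.length := by
  simp [strPow]

theorem strPow_succ (x : Str) (n : ℕ) : strPow x (n + 1) = x ++ strPow x n := by
  simp [strPow, List.replicate_succ]

/-! ## The lengths of the blocks -/

/-- The length of `R j`, divided by `k`. -/
def scale (k j : ℕ) : ℕ := k ^ Nat.clog k j

/-- The length of the `j`-th block. -/
def blockLength (k j : ℕ) : ℕ := 2 * (k * scale k j) ^ 2 + k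

/-- The length of the first `j` blocks. -/
def totalLength (k j : ℕ) : ℕ := ∑ i ∈ Finset.range j, blockLength k (i + 1)

theorem totalLength_succ (k j : ℕ) :
    totalLength k (j + 1) = totalLength k j + blockLength k (j + 1) :=
  Finset.sum_range_succ _ _

theorem le_scale {k : ℕ} (hk : 1 < k) (j : ℕ) : j ≤ scale k j := Nat.le_pow_clog hk j

theorem scale_pos {k : ℕ} (hk : 1 < k) (j : ℕ) : 0 < scale k j := Nat.pow_pos (by omega)

theorem scale_succ_le {k : ℕ} (hk : 1 < k) (j : ℕ) : scale k (j + 1) ≤ k * (j + 1) := by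
  rcases Nat.eq_zero_or_pos j with rfl | hj
  · simp [scale]; omega
  have h := Nat.pow_pred_clog_lt_self hk (x := j + 1) (by omega)
  have h2 : Nat.clog k (j + 1) ≠ 0 := (Nat.clog_pos hk (by omega)).ne'
  rw [scale, ← Nat.succ_pred_eq_of_ne_zero h2, pow_succ, mul_comm]
  exact Nat.mul_le_mul_left _ h.le

theorem blockLength_mono {k : ℕ} (hk : 1 < k) {i j : ℕ} (h : i ≤ j) :
    blockLength k i ≤ blockLength k j := by
  have : scale k i ≤ scale k j := Nat.pow_le_pow_right (by omega) (Nat.clog_mono_right k h)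
  unfold blockLength
  gcongr

theorem blockLength_pos {k : ℕ} (hk : 1 < k) (j : ℕ) : 0 < blockLength k j := by
  unfold blockLength; omega

theorem totalLength_le {k : ℕ} (hk : 1 < k) (j : ℕ) :
    totalLength k j ≤ scale k j * blockLength k j := by
  calc totalLength k j ≤ ∑ i ∈ Finset.range j, blockLength k j :=
        Finset.sum_le_sum fun i hi => blockLength_mono hk (Finset.mem_range.1 hi)
    _ = j * blockLength k j := by simp
    _ ≤ _ := Nat.mul_le_mul_right _ (le_scale hk j)

theorem totalLength_mono (k : ℕ) : Monotone (totalLength k) :=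
  monotone_nat_of_le_succ fun j => by rw [totalLength_succ]; omega

theorem pow_three_le_totalLength {k : ℕ} (hk : 1 < k) (j : ℕ) : j ^ 3 ≤ 3 * totalLength k j := by
  induction j with
  | zero => simp
  | succ j ih =>
    rw [totalLength_succ]
    have h1 : j + 1 ≤ k * scale k (j + 1) :=
      (le_scale hk (j + 1)).trans (Nat.le_mul_of_pos_left _ (by omega))
    have h2 : (j + 1) ^ 2 ≤ (k * scale k (j + 1)) ^ 2 := Nat.pow_le_pow_left h1 2
    unfold blockLength
    nlinarith

theorem le_totalLength {k : ℕ} (hk : 1 < k) (j : ℕ) : j ≤ totalLength k j := by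
  induction j with
  | zero => simp
  | succ j ih =>
    rw [totalLength_succ]
    have := blockLength_pos hk (j + 1)
    omega

theorem exists_mul_blockLength_le {k : ℕ} (hk : 1 < k) (N : ℕ) :
    ∃ j₀, ∀ j ≥ j₀, N * blockLength k (j + 1) ≤ totalLength k j := by
  refine ⟨36 * N * k ^ 4 + 1, fun j hj => ?_⟩
  have h1 : blockLength k (j + 1) ≤ 12 * k ^ 4 * j ^ 2 := by
    have h2 : (k * scale k (j + 1)) ^ 2 ≤ (k * (k * (j + 1))) ^ 2 :=
      Nat.pow_le_pow_left (Nat.mul_le_mul_left _ (scale_succ_le hk j)) 2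
    have h3 : k ≤ k ^ 4 := Nat.le_self_pow (by omega) k
    have hj1 : 1 ≤ j := by omega
    have h4 : (j + 1) ^ 2 ≤ 4 * j ^ 2 := by nlinarith
    have h5 : (k * (k * (j + 1))) ^ 2 = k ^ 4 * (j + 1) ^ 2 := by ring
    have h6 : k ^ 4 * (j + 1) ^ 2 ≤ k ^ 4 * (4 * j ^ 2) := Nat.mul_le_mul_left _ h4
    have h7 : k ^ 4 * 1 ≤ k ^ 4 * j ^ 2 := Nat.mul_le_mul_left _ (by nlinarith)
    unfold blockLength
    nlinarith
  have h2 := pow_three_le_totalLength hk j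
  have h3 : 36 * N * k ^ 4 * j ^ 2 ≤ j * j ^ 2 := Nat.mul_le_mul_right _ (by omega)
  have h4 : N * blockLength k (j + 1) ≤ N * (12 * k ^ 4 * j ^ 2) := Nat.mul_le_mul_left _ h1
  have h5 : 3 * (N * (12 * k ^ 4 * j ^ 2)) = 36 * N * k ^ 4 * j ^ 2 := by ring
  have h6 : j * j ^ 2 = j ^ 3 := by ring
  omega

theorem exists_totalLength_le_lt {k : ℕ} (hk : 1 < k) (n : ℕ) :
    ∃ j, totalLength k j ≤ n ∧ n < totalLength k (j + 1) := by
  have hex : ∃ j, n < totalLength k j := ⟨n + 1, le_totalLength hk (n + 1)⟩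
  classical
  have h0 : Nat.find hex ≠ 0 := fun h => by
    have := Nat.find_spec hex
    rw [h] at this
    simp [totalLength] at this
  refine ⟨Nat.find hex - 1, not_lt.1 (Nat.find_min hex (by omega)), ?_⟩
  rw [Nat.sub_add_cancel (by omega)]
  exact Nat.find_spec hex

/-- The blocks are eventually short in comparison with what precedes them. -/
theorem eventually_exists_block {k : ℕ} (hk : 1 < k) (N j₀ : ℕ) :
    ∀ᶠ n in atTop, ∃ j, j₀ ≤ j ∧ totalLength k j ≤ n ∧ n < totalLength k (j + 1) ∧
      N * blockLength k (j + 1) ≤ totalLength k j := by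
  obtain ⟨j₁, h⟩ := exists_mul_blockLength_le hk N
  filter_upwards [eventually_ge_atTop (totalLength k (j₀ + j₁))] with n hn
  obtain ⟨j, h1, h2⟩ := exists_totalLength_le_lt hk n
  have h3 : j₀ + j₁ < j + 1 := by
    by_contra h3
    have := totalLength_mono k (not_lt.1 h3)
    omega
  exact ⟨j, by omega, h1, h2, h j (by omega)⟩

/-! ## Sequences of blocks -/

/-- `S` is the concatenation of the blocks built from the strings `R (scale k j)`. -/
structure IsBlockSequence (S : BitSeq) (k : ℕ) (R : ℕ → Str) : Prop where
  length_eq : ∀ u, 0 < u → (R u).length = k * u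
  occurs : ∀ m, Occurs S 0 (blockPrefix (fun j => block k (R (scale k j))) m)

namespace IsBlockSequence

variable {S : BitSeq} {k : ℕ} {R : ℕ → Str}

theorem length_block (h : IsBlockSequence S k R) (hk : 1 < k) (j : ℕ) :
    (block k (R (scale k j))).length = blockLength k j := by
  simp only [block, List.length_append, length_strPow, List.length_replicate, List.length_reverse,
    h.length_eq _ (scale_pos hk j), blockLength]
  ring

theorem length_blockPrefix (h : IsBlockSequence S k R) (hk : 1 < k) (m : ℕ) :
    (blockPrefix (fun j => block k (R (scale k j))) m).length = totalLength k m := by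
  induction m with
  | zero => rfl
  | succ m ih =>
    rw [blockPrefix_succ, List.length_append, ih, totalLength_succ, h.length_block hk]

theorem seqPrefix_totalLength (h : IsBlockSequence S k R) (hk : 1 < k) (m : ℕ) :
    seqPrefix S (totalLength k m) = blockPrefix (fun j => block k (R (scale k j))) m := by
  rw [← h.length_blockPrefix hk, seqPrefix_of_occurs_zero (h.occurs m)]

theorem occurs_block (h : IsBlockSequence S k R) (hk : 1 < k) (m : ℕ) :
    Occurs S (totalLength k m) (block k (R (scale k (m + 1)))) := by
  have h1 := h.occurs (m + 1)
  rw [blockPrefix_succ, occurs_append, h.length_blockPrefix hk, Nat.zero_add] at h1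
  exact h1.2

end IsBlockSequence

theorem le_of_occurs_strPow {S : BitSeq} {w : Str} {g : ℕ → ℕ} {a p m : ℕ}
    (hg : ∀ q, Occurs S q w → q + w.length ≤ p + m * w.length → g q + a ≤ g (q + w.length))
    (h : Occurs S p (strPow w m)) : g p + m * a ≤ g (p + m * w.length) := by
  induction m generalizing p with
  | zero => simp
  | succ m ih =>
    rw [strPow_succ, occurs_append] at h
    rw [Nat.succ_mul] at hg
    have h1 := hg p h.1 (by omega)
    have h2 := ih (fun q hq h => hg q hq (by omega)) h.2
    rw [Nat.succ_mul, Nat.succ_mul]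
    rw [show p + w.length + m * w.length = p + (m * w.length + w.length) by omega] at h2
    omega

/-- A quantity that grows by at least `(k - 2) * u` with each occurrence of an `R u` or of its
reverse grows along `S` with a slope of at least `(k - 4) / k`. -/
theorem IsBlockSequence.eventually_le {S : BitSeq} {k : ℕ} {R : ℕ → Str}
    (h : IsBlockSequence S k R) (hk : 8 < k) (j₀ : ℕ) :
    ∀ᶠ n in atTop, ∀ g : ℕ → ℕ, Monotone g →
      (∀ j p w, j₀ < j → w = R (scale k j) ∨ w = (R (scale k j)).reverse → Occurs S p w →
        p + w.length ≤ n → p + w.length ≤ totalLength k j →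
        g p + (k - 2) * scale k j ≤ g (p + w.length)) →
      (k - 4) * n ≤ k * g n := by
  have hk1 : 1 < k := by omega
  filter_upwards [eventually_exists_block hk1 (k * (totalLength k j₀ + 1)) j₀] with
    n ⟨j, hj, h1, h2, h3⟩ g hmono hg
  have hblock : ∀ i, j₀ ≤ i → i < j →
      g (totalLength k i) + 2 * (k * scale k (i + 1) * ((k - 2) * scale k (i + 1))) ≤
        g (totalLength k (i + 1)) := by
    intro i hi hij
    have hocc := h.occurs_block hk1 i
    have hlen := h.length_eq _ (scale_pos hk1 (i + 1))
    have hlb := h.length_block hk1 (i + 1)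
    set r := R (scale k (i + 1)) with hr
    have hle : totalLength k (i + 1) ≤ n := (totalLength_mono k hij).trans h1
    have hsucc := totalLength_succ k i
    have hbl : blockLength k (i + 1) = r.length * r.length + k + r.length * r.length := by
      rw [hlen, blockLength]; ring
    rw [block, occurs_append, occurs_append] at hocc
    obtain ⟨⟨o1, -⟩, o3⟩ := hocc
    have g1 := le_of_occurs_strPow (g := g) (a := (k - 2) * scale k (i + 1)) (fun q hq hq' =>
      hg (i + 1) q r (by omega) (Or.inl hr) hq (by omega) (by omega)) o1
    have g2 := le_of_occurs_strPow (g := g) (a := (k - 2) * scale k (i + 1)) (fun q hq hq' =>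
      hg (i + 1) q r.reverse (by omega) (Or.inr (by rw [hr])) hq
        (by simp only [List.length_append, length_strPow, List.length_replicate,
              List.length_reverse] at hq' ⊢; omega)
        (by simp only [List.length_append, length_strPow, List.length_replicate,
              List.length_reverse] at hq' ⊢; omega)) o3
    simp only [List.length_append, length_strPow, List.length_replicate,
      List.length_reverse] at g1 g2
    have g3 : g (totalLength k i + r.length * r.length) ≤
        g (totalLength k i + (r.length * r.length + k)) := hmono (by omega)
    rw [hsucc, hbl]
    rw [show totalLength k i + (r.length * r.length + k) + r.length * r.length =
      totalLength k i + (r.length * r.length + k + r.length * r.length) by omega] at g2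
    rw [← hlen]
    omega
  have hsum : ∀ i, j₀ ≤ i → i ≤ j →
      (k - 3) * totalLength k i ≤ k * g (totalLength k i) + (k - 3) * totalLength k j₀ := by
    intro i hi
    induction i, hi using Nat.le_induction with
    | base => intro _; omega
    | succ i hi ih =>
      intro hij
      have h4 := ih (by omega)
      have h5 := hblock i hi (by omega)
      have h6 := scale_pos hk1 (i + 1)
      rw [totalLength_succ] at h5 ⊢
      unfold blockLength at h5 ⊢
      set v := scale k (i + 1)
      set a := g (totalLength k i)
      set b := g (totalLength k i + (2 * (k * v) ^ 2 + k))
      obtain ⟨k, rfl⟩ := Nat.exists_eq_add_of_lt hk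
      simp only [show 8 + k + 1 - 2 = k + 7 by omega, show 8 + k + 1 - 3 = k + 6 by omega] at *
      have h7 : (k + 6) * (2 * ((8 + k + 1) * v) ^ 2 + (8 + k + 1)) ≤
          (8 + k + 1) * (2 * ((8 + k + 1) * v * ((k + 7) * v))) := by
        have : 1 ≤ v * v := Nat.mul_pos h6 h6
        nlinarith [Nat.mul_le_mul_left ((8 + k + 1) * (8 + k + 1)) this]
      nlinarith
  have h4 := hsum j hj le_rfl
  have h5 : g (totalLength k j) ≤ g n := hmono h1
  have h6 := blockLength_pos hk1 (j + 1)
  rw [totalLength_succ] at h2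
  set b := blockLength k (j + 1)
  set t := totalLength k j
  set t₀ := totalLength k j₀
  obtain ⟨k, rfl⟩ := Nat.exists_eq_add_of_lt hk
  simp only [show 8 + k + 1 - 4 = k + 5 by omega, show 8 + k + 1 - 3 = k + 6 by omega] at *
  have h7 : (8 + k + 1) * t₀ * 1 ≤ (8 + k + 1) * t₀ * b := Nat.mul_le_mul_left _ h6
  have h8 : (k + 5) * n ≤ (k + 5) * (t + b) := Nat.mul_le_mul_left _ h2.le
  have h9 : (8 + k + 1) * g t ≤ (8 + k + 1) * g n := Nat.mul_le_mul_left _ h5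
  nlinarith

/-! ## A pushdown compressor for mirrored strings

In states `(i, false)` the input is copied to the output and onto the stack, where `i` ones are
still to be pushed; `k` successive ones lead to the states `(i, true)`, in which the input is
compared with the stack, and `i` is the number of matches modulo `k`. -/

namespace Mirror

variable {k : ℕ} [NeZero k]

/-- Count modulo `k`. -/
def inc (i : Fin k) : Fin k := if h : (i : ℕ) + 1 < k then ⟨i + 1, h⟩ else 0

theorem val_inc {i : Fin k} (h : (i : ℕ) + 1 < k) : ((inc i : Fin k) : ℕ) = i + 1 := by
  simp [inc, h]

/-- New state and pushed symbols when `b` is copied. -/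
def copy (i : Fin k) : Bool → (Fin k × Bool) × Str
  | false => ((0, false), false :: List.replicate i true)
  | true => ((inc i, decide ((i : ℕ) + 1 = k)), [])

/-- The string written when `b` is read. -/
def write : Fin k × Bool → Bool → Option Bool → Str
  | (_, false), b, _ => [b]
  | (i, true), b, a =>
    if a = some b then (if (i : ℕ) + 1 < k then [] else [true])
    else false :: (List.replicate i true ++ [false, b])

/-- The transition function on the state and the part of the stack above the bottom symbol. -/
def next : Fin k × Bool → Str → Bool → (Fin k × Bool) × Str
  | (i, false), s, b => ((copy i b).1, (copy i b).2 ++ s)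
  | (i, true), s, b =>
    if s.head? = some b then ((inc i, true), s.tail)
    else ((copy (0 : Fin k) b).1, (copy (0 : Fin k) b).2 ++ s)

variable (k) in
/-- The compressor. -/
def compressor : PushdownCompressor where
  State := Fin k × Bool
  finite_state := inferInstance
  δ q b a := match q, b with
    | _, none => none
    | (i, false), some b => some ((copy i b).1, (copy i b).2.map some ++ [a])
    | (i, true), some b =>
      if a = some b then some ((inc i, true), [])
      else some ((copy (0 : Fin k) b).1, (copy (0 : Fin k) b).2.map some ++ [a])
  ν q b a := b.elim [] fun b => write q b a
  start := (0, false)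
  c := 0
  keep_bottom := by
    rintro ⟨i, _ | _⟩ (_ | b) q' w h
    · simp at h
    · simp only [Option.some.injEq, Prod.mk.injEq] at h; exact ⟨_, h.2.symm⟩
    · simp at h
    · simp only [reduceCtorEq, if_false, Option.some.injEq, Prod.mk.injEq] at h
      exact ⟨_, h.2.symm⟩
  lambda_pop := by rintro ⟨i, _ | _⟩ a q' w h <;> simp at h
  deterministic := by rintro ⟨i, _ | _⟩ a <;> simp
  lambda_bound := by
    rintro ⟨⟨i, _ | _⟩, _ | ⟨a, s⟩, o⟩ <;> rfl

/-- The state and the stack after reading a string. -/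
def final : Fin k × Bool → Str → Str → (Fin k × Bool) × Str
  | q, s, [] => (q, s)
  | q, s, b :: x => final (next q s b).1 (next q s b).2 x

/-- The string written while reading a string. -/
def output : Fin k × Bool → Str → Str → Str
  | _, _, [] => []
  | q, s, b :: x => write q b s.head? ++ output (next q s b).1 (next q s b).2 x

theorem final_append (q : Fin k × Bool) (s x y : Str) :
    final q s (x ++ y) = final (final q s x).1 (final q s x).2 y := by
  induction x generalizing q s with
  | nil => rfl
  | cons b x ih => exact ih _ _

theorem output_append (q : Fin k × Bool) (s x y : Str) :
    output q s (x ++ y) = output q s x ++ output (final q s x).1 (final q s x).2 y := by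
  induction x generalizing q s with
  | nil => rfl
  | cons b x ih => simp [output, final, ih]

theorem step_eq (q : Fin k × Bool) (s o : Str) (b : Bool) :
    (compressor k).step (some b) { state := q, stack := s.map some ++ [none], out := o } =
      some { state := (next q s b).1, stack := (next q s b).2.map some ++ [none],
             out := o ++ write q b s.head? } := by
  obtain ⟨i, _ | _⟩ := q
  · cases s <;> simp [PDCData.step, compressor, next]
  · cases s with
    | nil => simp [PDCData.step, compressor, next]
    | cons a s =>
      by_cases h : a = b <;> simp [PDCData.step, compressor, next, h]

theorem runFrom_eq (q : Fin k × Bool) (s o x : Str) :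
    (compressor k).runFrom { state := q, stack := s.map some ++ [none], out := o } x =
      some { state := (final q s x).1, stack := (final q s x).2.map some ++ [none],
             out := o ++ output q s x } := by
  induction x generalizing q s o with
  | nil => simp [final, output]
  | cons b x ih =>
    rw [PDCData.runFrom_cons, step_eq]
    refine (ih _ _ _).trans ?_
    simp [final, output]

theorem run_eq (x : Str) :
    (compressor k).run x =
      some { state := (final ((0 : Fin k), false) [] x).1,
             stack := (final ((0 : Fin k), false) [] x).2.map some ++ [none],
             out := output ((0 : Fin k), false) [] x } :=
  runFrom_eq (0, false) [] [] x

theorem output_eq (x : Str) : (compressor k).output x = output ((0 : Fin k), false) [] x := by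
  rw [PDC.output, run_eq]

/-! ### Losslessness -/

theorem val_final_of_output_eq_nil {i : Fin k} {s x : Str} (h : output (i, true) s x = []) :
    ((final (i, true) s x).1.1 : ℕ) = i + x.length := by
  induction x generalizing i s with
  | nil => rfl
  | cons b x ih =>
    simp only [output, List.append_eq_nil_iff, write] at h
    obtain ⟨h1, h2⟩ := h
    split_ifs at h1 with h3 h4
    simp only [next, h3, if_true] at h2
    simp only [final, next, h3, if_true, List.length_cons]
    rw [ih h2, val_inc h4]
    omega

theorem output_pop_cases (i : Fin k) (s x : Str) :
    output (i, true) s x = [] ∨ (∃ r, output (i, true) s x = true :: r) ∨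
      ∃ (m : ℕ) (r : Str), (i : ℕ) ≤ m ∧
        output (i, true) s x = false :: (List.replicate m true ++ false :: r) := by
  induction x generalizing i s with
  | nil => exact Or.inl rfl
  | cons b x ih =>
    simp only [output, write]
    by_cases h3 : s.head? = some b
    · by_cases h4 : (i : ℕ) + 1 < k
      · simp only [h3, h4, if_true, List.nil_append, next]
        rcases ih (inc i) s.tail with h | h | ⟨m, r, h1, h2⟩
        · exact Or.inl h
        · exact Or.inr (Or.inl h)
        · refine Or.inr (Or.inr ⟨m, r, ?_, h2⟩)
          simp only [inc, h4, dif_pos] at h1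
          omega
      · simp [h3, h4]
    · exact Or.inr (Or.inr ⟨i, b :: output (next (i, true) s b).1 (next (i, true) s b).2 x,
        le_rfl, by simp [h3]⟩)

theorem replicate_true_append_inj {m n : ℕ} {r t : Str}
    (h : List.replicate m true ++ false :: r = List.replicate n true ++ false :: t) : m = n := by
  induction m generalizing n with
  | zero => cases n with
    | zero => rfl
    | succ n => simp [List.replicate_succ] at h
  | succ m ih => cases n with
    | zero => simp [List.replicate_succ] at h
    | succ n =>
      simp only [List.replicate_succ, List.cons_append, List.cons.injEq, true_and] at h
      rw [ih h]

theorem eq_nil_of_output {q : Fin k × Bool} {s x : Str} (h : output q s x = [])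
    (hq : (final q s x).1 = q) : x = [] := by
  obtain ⟨i, _ | _⟩ := q
  · cases x with
    | nil => rfl
    | cons b x => simp [output, write] at h
  · have := val_final_of_output_eq_nil h
    rw [hq] at this
    exact List.length_eq_zero_iff.1 (by simpa using this)

theorem output_match_ne {i : Fin k} {s x y : Str} {b b' : Bool} (hb : s.head? = some b)
    (hb' : s.head? ≠ some b') : output (i, true) s (b :: x) ≠ output (i, true) s (b' :: y) := by
  intro h
  simp only [output, write, if_pos hb, if_neg hb'] at h
  by_cases h4 : (i : ℕ) + 1 < k
  · simp only [h4, if_true, List.nil_append, next, hb] at h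
    rcases output_pop_cases (inc i) s.tail x with h' | ⟨r, h'⟩ | ⟨m, r, h1, h'⟩
    · simp [h'] at h
    · simp [h'] at h
    · simp only [h', List.cons_append, List.append_assoc, List.cons.injEq, true_and] at h
      have := replicate_true_append_inj h
      simp only [inc, h4, dif_pos] at h1
      omega
  · simp [h4] at h

theorem injective_aux {x y : Str} {q : Fin k × Bool} {s : Str}
    (h : output q s x = output q s y) (hq : (final q s x).1 = (final q s y).1) : x = y := by
  induction x generalizing y q s with
  | nil => exact (eq_nil_of_output h.symm hq.symm).symm
  | cons b x ih =>
    cases y with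
    | nil => exact eq_nil_of_output h hq
    | cons b' y =>
      have key : b = b' := by
        obtain ⟨i, _ | _⟩ := q
        · simp only [output, write, List.cons_append, List.cons.injEq] at h
          exact h.1
        · by_cases hb : s.head? = some b
          · by_cases hb' : s.head? = some b'
            · simpa [hb] using hb'
            · exact absurd h (output_match_ne hb hb')
          · by_cases hb' : s.head? = some b'
            · exact absurd h.symm (output_match_ne hb' hb)
            · simp [output, write, hb, hb'] at h
              exact h.1
      subst key
      rw [ih (List.append_cancel_left h) hq]

variable (k) in
theorem isLossless_compressor : (compressor k).IsLossless := by
  refine ⟨fun x => ⟨_, run_eq x⟩, fun x y h => ?_⟩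
  simp only [run_eq, Option.map_some, Option.some.injEq] at h
  exact injective_aux (congrArg Prod.fst h) (congrArg Prod.snd h)

/-! ### Output length -/

theorem length_output_le (q : Fin k × Bool) (s x : Str) :
    (output q s x).length ≤ (k + 2) * x.length := by
  induction x generalizing q s with
  | nil => simp [output]
  | cons b x ih =>
    have h1 : (write q b s.head?).length ≤ k + 2 := by
      obtain ⟨i, _ | _⟩ := q
      · simp [write]
      · have := i.2
        simp only [write]
        split_ifs <;> simp
    have h2 := ih (next q s b).1 (next q s b).2
    simp only [output, List.length_append, List.length_cons, Nat.mul_succ]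
    omega

theorem copy_run {z : Str} {i : Fin k} {s : Str}
    (h : ¬ List.replicate k true <:+: List.replicate i true ++ z) :
    output (i, false) s z = z ∧ ∃ (j : Fin k) (t : Str), final (i, false) s z = ((j, false), t) ∧
      List.replicate j true ++ t = z.reverse ++ (List.replicate i true ++ s) := by
  induction z generalizing i s with
  | nil => exact ⟨rfl, i, s, rfl, rfl⟩
  | cons b z ih =>
    cases b with
    | false =>
      obtain ⟨h1, j, t, h2, h3⟩ := ih (i := (0 : Fin k))
        (s := false :: (List.replicate i true ++ s)) (fun h' => h <| by
          simp only [Fin.val_zero, List.replicate_zero, List.nil_append] at h'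
          exact h'.trans ⟨List.replicate i true ++ [false], [], by simp⟩)
      exact ⟨by simp [output, write, next, copy, h1], j, t, h2, by simpa using h3⟩
    | true =>
      have hi : (i : ℕ) + 1 < k := by
        by_contra hi
        have : (i : ℕ) + 1 = k := by omega
        have e : List.replicate k true = List.replicate (i + 1) true := by rw [this]
        exact h ⟨[], z, by rw [e, List.replicate_succ']; simp⟩
      have hc := val_inc hi
      obtain ⟨h1, j, t, h2, h3⟩ := ih (i := inc i) (s := s) (by
        rw [hc, List.replicate_succ']; simpa using h)
      have hd : decide ((i : ℕ) + 1 = k) = false := by simp; omega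
      refine ⟨by simp [output, write, next, copy, h1, hd], j, t, ?_, ?_⟩
      · simp only [final, next, copy, hd]
        exact h2
      · rw [h3, hc, List.replicate_succ]; simp

theorem copy_run_zero {z : Str} (h : ¬ List.replicate k true <:+: z ++ [false]) (s : Str) :
    output ((0 : Fin k), false) s (z ++ [false]) = z ++ [false] ∧
      final ((0 : Fin k), false) s (z ++ [false]) = ((0, false), (z ++ [false]).reverse ++ s) := by
  have h0 : ¬ List.replicate k true <:+: List.replicate ((0 : Fin k) : ℕ) true ++ (z ++ [false]) := by
    simpa using h
  have h0' : ¬ List.replicate k true <:+: List.replicate ((0 : Fin k) : ℕ) true ++ z :=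
    fun h' => h0 (h'.trans ⟨[], [false], by simp⟩)
  obtain ⟨h1, -⟩ := copy_run (s := s) h0
  obtain ⟨-, j, t, h2, h3⟩ := copy_run (s := s) h0'
  refine ⟨h1, ?_⟩
  rw [final_append, h2]
  simp [final, next, copy, h3]

theorem copy_strPow {z : Str} (h : ¬ List.replicate k true <:+: z ++ [false]) (s : Str) (n : ℕ) :
    output ((0 : Fin k), false) s (strPow (z ++ [false]) n) = strPow (z ++ [false]) n ∧
      final ((0 : Fin k), false) s (strPow (z ++ [false]) n) =
        ((0, false), (strPow (z ++ [false]) n).reverse ++ s) := by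
  induction n generalizing s with
  | zero => exact ⟨rfl, rfl⟩
  | succ n ih =>
    obtain ⟨h1, h2⟩ := copy_run_zero h s
    obtain ⟨h3, h4⟩ := ih ((z ++ [false]).reverse ++ s)
    generalize z ++ [false] = w at *
    rw [strPow_succ, output_append, final_append, h1, h2]
    simp only [h3, h4]
    simp

theorem copy_ones (i : Fin k) (s : Str) (n : ℕ) (h : (i : ℕ) + n + 1 = k) :
    output (i, false) s (List.replicate (n + 1) true) = List.replicate (n + 1) true ∧
      final (i, false) s (List.replicate (n + 1) true) = ((0, true), s) := by
  induction n generalizing i with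
  | zero =>
    have : ¬ (i : ℕ) + 1 < k := by omega
    have h' : (i : ℕ) + 1 = k := by omega
    simp [output, final, write, next, copy, inc, h']
  | succ n ih =>
    have h1 : (i : ℕ) + 1 < k := by omega
    have h2 : ¬ (i : ℕ) + 1 = k := by omega
    obtain ⟨h3, h4⟩ := ih (inc i) (by simp only [inc, h1, dif_pos]; omega)
    rw [List.replicate_succ]
    constructor
    · simp [output, write, next, copy, h2, h3]
    · simp [final, next, copy, h2, h4]

theorem pop_run (i : Fin k) (z s : Str) :
    (output (i, true) (z ++ s) z).length = (i + z.length) / k ∧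
      (final (i, true) (z ++ s) z).2 = s ∧ (final (i, true) (z ++ s) z).1.2 = true ∧
      ((final (i, true) (z ++ s) z).1.1 : ℕ) = (i + z.length) % k := by
  induction z generalizing i with
  | nil => simp [output, final, Nat.div_eq_of_lt, Nat.mod_eq_of_lt]
  | cons b z ih =>
    obtain ⟨h1, h2, h3, h4⟩ := ih (inc i)
    have hn : next (i, true) (b :: z ++ s) b = ((inc i, true), z ++ s) := by simp [next]
    by_cases h : (i : ℕ) + 1 < k
    · have hi : ((inc i : Fin k) : ℕ) = i + 1 := by simp [inc, h]
      simp only [output, final, hn, h2, h3, h4, List.length_append, h1, hi, List.length_cons]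
      simp [write, h, Nat.add_assoc, Nat.add_comm 1]
    · have hi : ((inc i : Fin k) : ℕ) = 0 := by simp [inc, h]
      have e : (i : ℕ) + (z.length + 1) = z.length + k := by omega
      simp only [output, final, hn, h2, h3, h4, List.length_append, h1, hi, List.length_cons, e]
      simp [write, h, Nat.add_div_right _ (Nat.pos_of_neZero k), Nat.add_comm 1]

theorem reverse_strPow (x : Str) (n : ℕ) : (strPow x n).reverse = strPow x.reverse n := by
  simp [strPow, List.reverse_flatten]

theorem block_run {R : Str} {u : ℕ} (hk : 1 < k) (hR : R ∈ candidates k u)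
    {m : Bool} :
    (output ((0 : Fin k), m) [] (block k R)).length ≤
        R.length * R.length + k + R.length * u + 2 ∧
      final ((0 : Fin k), m) [] (block k R) = ((0, true), []) := by
  obtain ⟨hlen, hinf, z, hz⟩ := hR
  have hpush : (output ((0 : Fin k), false) [] (block k R)).length =
        R.length * R.length + k + R.length * u ∧
      final ((0 : Fin k), false) [] (block k R) = ((0, true), []) := by
    obtain ⟨h1, h2⟩ := copy_strPow (hz ▸ hinf) [] R.length
    rw [← hz] at h1 h2
    obtain ⟨h3, h4⟩ := copy_ones (0 : Fin k) (strPow R.reverse R.length) (k - 1)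
      (by simp only [Fin.val_zero]; omega)
    rw [Nat.sub_add_cancel hk.le] at h3 h4
    obtain ⟨h5, h6, h7, h8⟩ := pop_run (0 : Fin k) (strPow R.reverse R.length) []
    have e : R.length * R.length = R.length * u * k := by rw [hlen]; ring
    simp only [Fin.val_zero, length_strPow, List.length_reverse, Nat.zero_add, e,
      Nat.mul_mod_left, Nat.mul_div_left _ (Nat.pos_of_neZero k), List.append_nil] at h5 h6 h7 h8
    rw [reverse_strPow, List.append_nil] at h2
    have e1 : final ((0 : Fin k), false) [] (strPow R R.length ++ List.replicate k true) =
      ((0, true), strPow R.reverse R.length) := by rw [final_append, h2, h4]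
    rw [block]
    refine ⟨?_, ?_⟩
    · rw [output_append, e1, output_append, h2, h1, h3]
      simp only [List.length_append, length_strPow, List.length_replicate, h5]
    · rw [final_append, e1]
      exact Prod.ext (Prod.ext (Fin.ext (by simpa using h8)) h7) h6
  cases m with
  | false => exact ⟨by omega, hpush.2⟩
  | true =>
    have hne : block k R ≠ [] := fun h => by
      have := congrArg List.length h
      simp only [block, List.length_append, List.length_replicate, List.length_nil] at this
      omega
    obtain ⟨b, x, hx⟩ := List.exists_cons_of_ne_nil hne
    rw [hx] at hpush ⊢
    simp only [output, final, write, next, List.length_append, List.head?_nil, reduceCtorEq,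
      if_false, List.length_cons, List.length_nil, Fin.val_zero, List.replicate_zero] at hpush ⊢
    exact ⟨by omega, hpush.2⟩

end Mirror

theorem IsBlockSequence.eventually_mirror_le {S : BitSeq} {k : ℕ} [NeZero k] {R : ℕ → Str}
    (h : IsBlockSequence S k R) (hk : 1 < k) (hR : ∀ u, 0 < u → R u ∈ candidates k u) :
    ∀ᶠ n in atTop, 2 * k * ((Mirror.compressor k).output (seqPrefix S n)).length ≤
      (k + 5) * n := by
  have hpre : ∀ j, ∃ m, Mirror.final ((0 : Fin k), false) [] (seqPrefix S (totalLength k j)) =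
      ((0, m), []) ∧ 2 * k * (Mirror.output ((0 : Fin k), false) []
        (seqPrefix S (totalLength k j))).length ≤ (k + 4) * totalLength k j := by
    intro j
    induction j with
    | zero => exact ⟨false, rfl, by simp [totalLength, seqPrefix, Mirror.output]⟩
    | succ j ih =>
      obtain ⟨m, h1, h2⟩ := ih
      have hu := scale_pos hk (j + 1)
      obtain ⟨h3, h4⟩ := Mirror.block_run hk (hR _ hu) (m := m)
      rw [h.length_eq _ hu] at h3
      have hs : seqPrefix S (totalLength k (j + 1)) =
          seqPrefix S (totalLength k j) ++ block k (R (scale k (j + 1))) := by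
        rw [← (h.occurs_block hk j).seqPrefix_add, h.length_block hk, totalLength_succ]
      refine ⟨true, ?_, ?_⟩
      · rw [hs, Mirror.final_append, h1]; exact h4
      · rw [hs, Mirror.output_append, h1, totalLength_succ, blockLength, List.length_append]
        generalize scale k (j + 1) = u at *
        have h5 : 2 * k * _ ≤ 2 * k * _ := Nat.mul_le_mul_left (2 * k) h3
        have h6 : k ^ 2 * 1 ≤ k ^ 2 * (u * u) := Nat.mul_le_mul_left _ (Nat.mul_pos hu hu)
        nlinarith
  filter_upwards [eventually_exists_block hk (2 * k * (k + 2)) 0] with n hn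
  obtain ⟨j, -, h1, h2, h3⟩ := hn
  obtain ⟨m, -, h5⟩ := hpre j
  obtain ⟨t, ht, hlen⟩ := exists_seqPrefix_eq_append S h1
  rw [Mirror.output_eq, ht, Mirror.output_append, List.length_append, Nat.mul_add]
  have h6 := Mirror.length_output_le
    (Mirror.final ((0 : Fin k), false) [] (seqPrefix S (totalLength k j))).1
    (Mirror.final ((0 : Fin k), false) [] (seqPrefix S (totalLength k j))).2 t
  have h7 : t.length ≤ blockLength k (j + 1) := by rw [totalLength_succ] at h2; omega
  have h8 : 2 * k * _ ≤ 2 * k * _ :=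
    Nat.mul_le_mul_left (2 * k) (h6.trans (Nat.mul_le_mul_left _ h7))
  have h9 : (k + 5) * totalLength k j ≤ (k + 5) * n := Nat.mul_le_mul_left _ h1
  nlinarith

/-! ## A pebble transducer that produces blocks

The input consists of cells `1 b` for the bits `b` of each string `R`, a separator `0` after each
`R`, a further `0`, and a string that is copied. The first pebble marks the first cell of `R`, the
second one runs through the cells of `R`, once for each copy of `R` and of its reverse. -/

namespace Expander

/-- The program: new state, action and output, depending on the state, the tape symbol and the
presence of the two pebbles. -/
def program (k : ℕ) (q : Fin 23) (a : TapeSymbol) (m₀ m₁ : Bool) :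
    Fin 23 × PebbleAction × Str :=
  match q.val, a with
  | 0, _ => (1, .right, [])
  | 1, .bit true => (2, .push, [])
  | 1, _ => (18, .right, [])
  | 2, .bit true => (3, .push, [])
  | 2, _ => (8, .left, List.replicate k true)
  | 3, _ => if m₀ then (5, .right, []) else (3, .left, [])
  | 4, .bit true => (5, .right, [])
  | 4, _ => (6, .left, [])
  | 5, .bit b => (4, .right, [b])
  | 6, _ => if m₁ then (7, .pop, []) else (6, .left, [])
  | 7, _ => (9, .right, [])
  | 9, _ => (2, .right, [])
  | 8, _ => if m₀ then (10, .push, []) else (8, .left, [])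
  | 10, .bit true => (11, .right, [])
  | 10, _ => (12, .left, [])
  | 11, _ => (10, .right, [])
  | 12, .bit b => (13, .left, [b])
  | 13, _ => if m₀ then (if m₁ then (15, .pop, []) else (14, .right, [])) else (12, .left, [])
  | 14, _ => if m₁ then (15, .pop, []) else (14, .right, [])
  | 15, _ => (16, .right, [])
  | 16, _ => (17, .right, [])
  | 17, .bit true => (10, .push, [])
  | 17, _ => (19, .left, [])
  | 19, _ => if m₀ then (20, .pop, []) else (19, .left, [])
  | 20, .bit true => (21, .right, [])
  | 20, _ => (1, .right, [])
  | 21, _ => (20, .right, [])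
  | 18, .bit b => (18, .right, [b])
  | _, _ => (22, .left, [])

/-- The transducer. -/
def transducer (k : ℕ) : PebbleTransducer where
  numStates := 23
  start := 0
  final := {22}
  numPebbles := 2
  δ q a m := ((program k q.1 a (m 0) (m 1)).1, (program k q.1 a (m 0) (m 1)).2.1)
  ν q a m := (program k q.1 a (m 0) (m 1)).2.2

/-- The configuration with the given state, head position, pebbles and output. -/
def conf (k : ℕ) (q : Fin 23) (i : ℕ) (p : List ℕ) (o : Str) : (transducer k).Config :=
  { state := q, head := i, pebbles := p, out := o }

/-- The configuration `c` leads to the configuration `d`. -/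
def Leads (k : ℕ) (x : Str) (c d : (transducer k).Config) : Prop :=
  Relation.ReflTransGen (fun c d => (transducer k).step x c = some d) c d

variable {k : ℕ} {x : Str}

theorem Leads.refl (c : (transducer k).Config) : Leads k x c c := Relation.ReflTransGen.refl

theorem Leads.trans {c d e : (transducer k).Config} (h : Leads k x c d) (h' : Leads k x d e) :
    Leads k x c e := Relation.ReflTransGen.trans h h'

theorem step_eq {q : Fin 23} (hq : q ≠ 22) (i : ℕ) (p : List ℕ) (o : Str) :
    (transducer k).step x (conf k q i p o) =
      ((transducer k).act (tapeSymbol x i) i p (program k q (tapeSymbol x i)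
        (decide (p[0]? = some i)) (decide (p[1]? = some i))).2.1).map fun m =>
      conf k (program k q (tapeSymbol x i)
        (decide (p[0]? = some i)) (decide (p[1]? = some i))).1 m.1 m.2
        (o ++ (program k q (tapeSymbol x i)
        (decide (p[0]? = some i)) (decide (p[1]? = some i))).2.2) := by
  have h : ¬ (conf k q i p o).state ∈ (transducer k).final := by
    exact fun h => hq (Finset.mem_singleton.1 h)
  rw [PebbleTransducer.step, dif_neg h]
  rfl

variable {q q' : Fin 23} {i : ℕ} {p : List ℕ} {o w : Str} {b : Bool}

theorem leads_right (hq : q ≠ 22) (hi : tapeSymbol x i = .bit b)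
    (h : program k q (.bit b) (decide (p[0]? = some i)) (decide (p[1]? = some i)) =
      (q', .right, w)) :
    Leads k x (conf k q i p o) (conf k q' (i + 1) p (o ++ w)) :=
  Relation.ReflTransGen.single (by rw [step_eq hq, hi, h]; rfl)

theorem leads_left (hq : q ≠ 22) (hi : tapeSymbol x i = .bit b)
    (h : program k q (.bit b) (decide (p[0]? = some i)) (decide (p[1]? = some i)) =
      (q', .left, w)) :
    Leads k x (conf k q i p o) (conf k q' (i - 1) p (o ++ w)) :=
  Relation.ReflTransGen.single (by rw [step_eq hq, hi, h]; rfl)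

theorem leads_push (hq : q ≠ 22) (hi : tapeSymbol x i = .bit b) (hp : p.length < 2)
    (h : program k q (.bit b) (decide (p[0]? = some i)) (decide (p[1]? = some i)) =
      (q', .push, w)) :
    Leads k x (conf k q i p o) (conf k q' i (p ++ [i]) (o ++ w)) :=
  Relation.ReflTransGen.single (by
    rw [step_eq hq, hi, h]
    have : p.length < (transducer k).numPebbles := hp
    simp [PebbleTransducer.act, this])

theorem leads_pop (hq : q ≠ 22) (hi : tapeSymbol x i = .bit b)
    (h : program k q (.bit b) (decide ((p ++ [i])[0]? = some i))
      (decide ((p ++ [i])[1]? = some i)) = (q', .pop, w)) :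
    Leads k x (conf k q i (p ++ [i]) o) (conf k q' i p (o ++ w)) :=
  Relation.ReflTransGen.single (by
    rw [step_eq hq, hi, h]
    simp [PebbleTransducer.act])

theorem leads_left_search {m : ℕ} (d : ℕ)
    (h : ∀ i, m < i → i ≤ m + d → Leads k x (conf k q i p o) (conf k q (i - 1) p o)) :
    Leads k x (conf k q (m + d) p o) (conf k q m p o) := by
  induction d with
  | zero => exact Leads.refl _
  | succ d ih =>
    exact (h (m + (d + 1)) (by omega) le_rfl).trans (ih fun i h1 h2 => h i h1 (by omega))

theorem leads_right_search {m : ℕ} (d : ℕ)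
    (h : ∀ i, m ≤ i → i < m + d → Leads k x (conf k q i p o) (conf k q (i + 1) p o)) :
    Leads k x (conf k q m p o) (conf k q (m + d) p o) := by
  induction d with
  | zero => exact Leads.refl _
  | succ d ih =>
    exact (ih fun i h1 h2 => h i h1 (by omega)).trans (h (m + d) (by omega) (by omega))

/-- The cells of `R`, followed by a separator, are on the tape from square `s` on. -/
structure OnTape (x : Str) (s : ℕ) (R : Str) : Prop where
  marker : ∀ i < R.length, tapeSymbol x (s + 2 * i) = .bit true
  bit : ∀ i (h : i < R.length), tapeSymbol x (s + 2 * i + 1) = .bit R[i]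
  separator : tapeSymbol x (s + 2 * R.length) = .bit false

variable {s : ℕ} {R : Str}

theorem OnTape.exists_bit (h : OnTape x s R) {i : ℕ} (h1 : s ≤ i) (h2 : i ≤ s + 2 * R.length) :
    ∃ b, tapeSymbol x i = .bit b := by
  obtain ⟨j, rfl⟩ := Nat.exists_eq_add_of_le h1
  rcases Nat.even_or_odd' j with ⟨c, rfl | rfl⟩
  · rcases lt_or_ge c R.length with hc | hc
    · exact ⟨_, h.marker c hc⟩
    · obtain rfl : c = R.length := by omega
      exact ⟨_, h.separator⟩
  · exact ⟨_, h.bit c (by omega)⟩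

/-- Write the cells from cell `j` on. -/
theorem leads_emit (h : OnTape x s R) (p : List ℕ) (o : Str) (d j : ℕ) (hj : j + d = R.length) :
    Leads k x (conf k 4 (s + 2 * j) p o)
      (conf k 4 (s + 2 * R.length) p (o ++ R.drop j)) := by
  induction d generalizing j o with
  | zero =>
    obtain rfl : j = R.length := by omega
    simpa using Leads.refl _
  | succ d ih =>
    have hj' : j < R.length := by omega
    have h1 := leads_right (k := k) (q := 4) (p := p) (o := o) (by decide) (h.marker j hj') rfl
    have h2 := leads_right (k := k) (q := 5) (p := p) (o := o ++ []) (by decide) (h.bit j hj') rfl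
    have h3 := ih (o ++ [] ++ [R[j]]) (j + 1) (by omega)
    rw [List.drop_eq_getElem_cons hj']
    simpa using h1.trans (h2.trans h3)

/-- Go to the separator. -/
theorem leads_separator {q q' : Fin 23} (hq : q ≠ 22) (hq' : q' ≠ 22)
    (h1 : ∀ m₀ m₁, program k q (.bit true) m₀ m₁ = (q', .right, []))
    (h2 : ∀ b m₀ m₁, program k q' (.bit b) m₀ m₁ = (q, .right, []))
    (h : OnTape x s R) (p : List ℕ) (o : Str) (d j : ℕ) (hj : j + d = R.length) :
    Leads k x (conf k q (s + 2 * j) p o) (conf k q (s + 2 * R.length) p o) := by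
  induction d generalizing j with
  | zero =>
    obtain rfl : j = R.length := by omega
    exact Leads.refl _
  | succ d ih =>
    have hj' : j < R.length := by omega
    have e1 := leads_right (p := p) (o := o) hq (h.marker j hj') (h1 _ _)
    have e2 := leads_right (p := p) (o := o ++ []) hq' (h.bit j hj') (h2 _ _ _)
    have e3 := ih (j + 1) (by omega)
    simp only [List.append_nil] at e1 e2
    exact e1.trans (e2.trans e3)

/-- Write the cells from cell `j` on in reverse order. -/
theorem leads_emit_reverse (h : OnTape x s R) (r : ℕ) (o : Str) (j : ℕ) (hj : j < R.length) :
    Leads k x (conf k 12 (s + 2 * j + 1) [s, r] o)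
      (conf k 13 s [s, r] (o ++ (R.take (j + 1)).reverse)) := by
  induction j generalizing o with
  | zero =>
    have h1 := leads_left (k := k) (q := 12) (p := [s, r]) (o := o) (by decide) (h.bit 0 hj) rfl
    have e : R.take (0 + 1) = [R[0]] := by
      rw [List.take_succ_eq_append_getElem hj]; simp
    rw [e]
    simpa using h1
  | succ j ih =>
    have h1 := leads_left (k := k) (q := 12) (p := [s, r]) (o := o) (by decide)
      (h.bit (j + 1) hj) rfl
    have hd : decide (([s, r] : List ℕ)[0]? = some (s + 2 * (j + 1))) = false := by
      simp
    have h2 := leads_left (k := k) (q := 13) (q' := 12) (p := [s, r]) (o := o ++ [R[j + 1]])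
      (w := []) (by decide) (h.marker (j + 1) hj) (by rw [hd]; rfl)
    have h3 := ih (o ++ [R[j + 1]]) (by omega)
    rw [List.take_succ_eq_append_getElem hj, List.reverse_append]
    rw [List.append_nil, show s + 2 * (j + 1) - 1 = s + 2 * j + 1 by omega] at h2
    rw [Nat.add_sub_cancel] at h1
    simpa using h1.trans (h2.trans h3)

theorem leads_forward_step (h : OnTape x s R) (o : Str) (j : ℕ) (hj : j < R.length) :
    Leads k x (conf k 2 (s + 2 * j) [s] o) (conf k 2 (s + 2 * (j + 1)) [s] (o ++ R)) := by
  have h1 : Leads k x (conf k 2 (s + 2 * j) [s] o) (conf k 3 (s + 2 * j) [s, s + 2 * j] o) := by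
    simpa using leads_push (k := k) (q := 2) (p := [s]) (o := o) (by decide) (h.marker j hj)
      (by simp) rfl
  have h2 : Leads k x (conf k 3 (s + 2 * j) [s, s + 2 * j] o)
      (conf k 3 s [s, s + 2 * j] o) := by
    refine leads_left_search (2 * j) fun i hi hi' => ?_
    obtain ⟨b, hb⟩ := h.exists_bit hi.le (by omega)
    have hd : decide (([s, s + 2 * j] : List ℕ)[0]? = some i) = false := by simp; omega
    simpa using leads_left (k := k) (q := 3) (q' := 3) (p := [s, s + 2 * j]) (o := o) (w := [])
      (by decide) hb (by rw [hd]; rfl)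
  have h3 : Leads k x (conf k 3 s [s, s + 2 * j] o) (conf k 5 (s + 1) [s, s + 2 * j] o) := by
    have hd : decide (([s, s + 2 * j] : List ℕ)[0]? = some s) = true := by simp
    simpa using leads_right (k := k) (q := 3) (q' := 5) (p := [s, s + 2 * j]) (o := o) (w := [])
      (by decide) (h.marker 0 (by omega)) (by rw [Nat.mul_zero, Nat.add_zero, hd]; rfl)
  have h0 : 0 < R.length := by omega
  have h4 : Leads k x (conf k 5 (s + 1) [s, s + 2 * j] o)
      (conf k 4 (s + 2) [s, s + 2 * j] (o ++ [R[0]])) := by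
    simpa using leads_right (k := k) (q := 5) (p := [s, s + 2 * j]) (o := o)
      (by decide) (h.bit 0 h0) rfl
  have h5 : Leads k x (conf k 4 (s + 2) [s, s + 2 * j] (o ++ [R[0]]))
      (conf k 4 (s + 2 * R.length) [s, s + 2 * j] (o ++ R)) := by
    have := leads_emit (k := k) h [s, s + 2 * j] (o ++ [R[0]]) (R.length - 1) 1 (by omega)
    rw [List.append_assoc, List.singleton_append, ← List.drop_eq_getElem_cons h0] at this
    simpa using this
  have h6 : Leads k x (conf k 4 (s + 2 * R.length) [s, s + 2 * j] (o ++ R))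
      (conf k 6 (s + 2 * R.length - 1) [s, s + 2 * j] (o ++ R)) := by
    simpa using leads_left (k := k) (q := 4) (p := [s, s + 2 * j]) (o := o ++ R) (by decide)
      h.separator rfl
  have h7 : Leads k x (conf k 6 (s + 2 * R.length - 1) [s, s + 2 * j] (o ++ R))
      (conf k 6 (s + 2 * j) [s, s + 2 * j] (o ++ R)) := by
    obtain ⟨d, hd⟩ : ∃ d, s + 2 * R.length - 1 = s + 2 * j + d := ⟨2 * R.length - 1 - 2 * j, by omega⟩
    rw [hd]
    refine leads_left_search d fun i hi hi' => ?_
    obtain ⟨b, hb⟩ := h.exists_bit (i := i) (by omega) (by omega)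
    have hd : decide (([s, s + 2 * j] : List ℕ)[1]? = some i) = false := by simp; omega
    simpa using leads_left (k := k) (q := 6) (q' := 6) (p := [s, s + 2 * j]) (o := o ++ R)
      (w := []) (by decide) hb (by rw [hd]; rfl)
  have h8 : Leads k x (conf k 6 (s + 2 * j) [s, s + 2 * j] (o ++ R))
      (conf k 7 (s + 2 * j) [s] (o ++ R)) := by
    have hd : decide ((([s] : List ℕ) ++ [s + 2 * j])[1]? = some (s + 2 * j)) = true := by simp
    simpa using leads_pop (k := k) (q := 6) (q' := 7) (p := [s]) (o := o ++ R)
      (w := []) (by decide) (h.marker j hj) (by rw [hd]; rfl)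
  have h9 := leads_right (k := k) (q := 7) (p := [s]) (o := o ++ R) (by decide) (h.marker j hj) rfl
  have h10 := leads_right (k := k) (q := 9) (p := [s]) (o := o ++ R) (by decide) (h.bit j hj) rfl
  simp only [List.append_nil] at h9 h10
  exact h1.trans (h2.trans (h3.trans (h4.trans (h5.trans (h6.trans (h7.trans (h8.trans
    (h9.trans h10))))))))

theorem leads_forward (h : OnTape x s R) (o : Str) (d j : ℕ) (hj : j + d = R.length) :
    Leads k x (conf k 2 (s + 2 * j) [s] o)
      (conf k 2 (s + 2 * R.length) [s] (o ++ strPow R d)) := by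
  induction d generalizing j o with
  | zero =>
    obtain rfl : j = R.length := by omega
    simpa [strPow] using Leads.refl _
  | succ d ih =>
    rw [strPow_succ, ← List.append_assoc]
    exact (leads_forward_step h o j (by omega)).trans (ih _ (j + 1) (by omega))

theorem leads_backward_step (h : OnTape x s R) (o : Str) (j : ℕ) (hj : j < R.length) :
    Leads k x (conf k 10 (s + 2 * j) [s, s + 2 * j] o)
      (conf k 17 (s + 2 * (j + 1)) [s] (o ++ R.reverse)) := by
  have h1 := leads_separator (k := k) (q := 10) (q' := 11) (by decide) (by decide)
    (fun _ _ => rfl) (fun _ _ _ => rfl) h [s, s + 2 * j] o (R.length - j) j (by omega)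
  have h2 : Leads k x (conf k 10 (s + 2 * R.length) [s, s + 2 * j] o)
      (conf k 12 (s + 2 * (R.length - 1) + 1) [s, s + 2 * j] o) := by
    rw [show s + 2 * (R.length - 1) + 1 = s + 2 * R.length - 1 by omega]
    simpa using leads_left (k := k) (q := 10) (p := [s, s + 2 * j]) (o := o) (by decide)
      h.separator rfl
  have h3 := leads_emit_reverse (k := k) h (s + 2 * j) o (R.length - 1) (by omega)
  rw [Nat.sub_add_cancel (by omega), List.take_length] at h3
  have h4 : Leads k x (conf k 13 s [s, s + 2 * j] (o ++ R.reverse))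
      (conf k 15 (s + 2 * j) [s] (o ++ R.reverse)) := by
    rcases Nat.eq_zero_or_pos j with rfl | hj0
    · have hd0 : decide ((([s] : List ℕ) ++ [s])[0]? = some s) = true := by simp
      have hd1 : decide ((([s] : List ℕ) ++ [s])[1]? = some s) = true := by simp
      simpa using leads_pop (k := k) (q := 13) (q' := 15) (p := [s]) (o := o ++ R.reverse)
        (w := []) (by decide) (h.marker 0 hj) (by
          rw [Nat.mul_zero, Nat.add_zero, hd0, hd1]; rfl)
    · have g1 : Leads k x (conf k 13 s [s, s + 2 * j] (o ++ R.reverse))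
          (conf k 14 (s + 1) [s, s + 2 * j] (o ++ R.reverse)) := by
        have hd0 : decide (([s, s + 2 * j] : List ℕ)[0]? = some s) = true := by simp
        have hd1 : decide (([s, s + 2 * j] : List ℕ)[1]? = some s) = false := by simp; omega
        simpa using leads_right (k := k) (q := 13) (q' := 14) (p := [s, s + 2 * j])
          (o := o ++ R.reverse) (w := []) (by decide) (h.marker 0 (by omega)) (by
            rw [Nat.mul_zero, Nat.add_zero, hd0, hd1]; rfl)
      have g2 : Leads k x (conf k 14 (s + 1) [s, s + 2 * j] (o ++ R.reverse))
          (conf k 14 (s + 2 * j) [s, s + 2 * j] (o ++ R.reverse)) := by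
        have := leads_right_search (k := k) (x := x) (q := 14) (p := [s, s + 2 * j])
          (o := o ++ R.reverse) (m := s + 1) (2 * j - 1) fun i hi hi' => by
            obtain ⟨b, hb⟩ := h.exists_bit (i := i) (by omega) (by omega)
            have hd : decide (([s, s + 2 * j] : List ℕ)[1]? = some i) = false := by simp; omega
            simpa using leads_right (k := k) (q := 14) (q' := 14) (p := [s, s + 2 * j])
              (o := o ++ R.reverse) (w := []) (by decide) hb (by rw [hd]; rfl)
        rwa [show s + 1 + (2 * j - 1) = s + 2 * j by omega] at this
      have g3 : Leads k x (conf k 14 (s + 2 * j) [s, s + 2 * j] (o ++ R.reverse))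
          (conf k 15 (s + 2 * j) [s] (o ++ R.reverse)) := by
        have hd : decide ((([s] : List ℕ) ++ [s + 2 * j])[1]? = some (s + 2 * j)) = true := by
          simp
        simpa using leads_pop (k := k) (q := 14) (q' := 15) (p := [s]) (o := o ++ R.reverse)
          (w := []) (by decide) (h.marker j hj) (by rw [hd]; rfl)
      exact g1.trans (g2.trans g3)
  have h5 := leads_right (k := k) (q := 15) (p := [s]) (o := o ++ R.reverse) (by decide)
    (h.marker j hj) rfl
  have h6 := leads_right (k := k) (q := 16) (p := [s]) (o := o ++ R.reverse) (by decide)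
    (h.bit j hj) rfl
  simp only [List.append_nil] at h5 h6
  exact h1.trans (h2.trans (h3.trans (h4.trans (h5.trans h6))))

theorem leads_backward (h : OnTape x s R) (o : Str) (d j : ℕ) (hj : j + d + 1 = R.length) :
    Leads k x (conf k 10 (s + 2 * j) [s, s + 2 * j] o)
      (conf k 17 (s + 2 * R.length) [s] (o ++ strPow R.reverse (d + 1))) := by
  induction d generalizing j o with
  | zero =>
    have := leads_backward_step (k := k) h o j (by omega)
    rw [show j + 1 = R.length by omega] at this
    simpa [strPow] using this
  | succ d ih =>
    have h1 := leads_backward_step (k := k) h o j (by omega)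
    have h2 := leads_push (k := k) (q := 17) (p := [s]) (o := o ++ R.reverse) (by decide)
      (h.marker (j + 1) (by omega)) (by simp) rfl
    rw [strPow_succ, ← List.append_assoc]
    rw [List.append_nil] at h2
    exact h1.trans (h2.trans (ih _ (j + 1) (by omega)))

theorem leads_block (h : OnTape x s R) (hR : 0 < R.length) (o : Str) :
    Leads k x (conf k 1 s [] o)
      (conf k 1 (s + 2 * R.length + 1) [] (o ++ block k R)) := by
  have h1 : Leads k x (conf k 1 s [] o) (conf k 2 (s + 2 * 0) [s] o) := by
    simpa using leads_push (k := k) (q := 1) (p := []) (o := o) (by decide) (h.marker 0 hR)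
      (by simp) rfl
  have h2 := leads_forward (k := k) h o R.length 0 (by omega)
  have h3 := leads_left (k := k) (q := 2) (p := [s]) (o := o ++ strPow R R.length) (by decide)
    h.separator rfl
  set o' := o ++ strPow R R.length ++ List.replicate k true with ho'
  have hsearch : ∀ (q : Fin 23) (o : Str), q ≠ 22 →
      (∀ b m₁, program k q (.bit b) false m₁ = (q, .left, [])) →
      Leads k x (conf k q (s + 2 * R.length - 1) [s] o) (conf k q s [s] o) := by
    intro q o hq hprog
    have := leads_left_search (k := k) (x := x) (q := q) (p := [s]) (o := o) (m := s)
      (2 * R.length - 1) fun i hi hi' => by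
        obtain ⟨b, hb⟩ := h.exists_bit (i := i) (by omega) (by omega)
        have hd : decide (([s] : List ℕ)[0]? = some i) = false := by simp; omega
        simpa using leads_left (k := k) (q := q) (q' := q) (p := [s]) (o := o) (w := [])
          hq hb (by rw [hd, hprog])
    rwa [show s + (2 * R.length - 1) = s + 2 * R.length - 1 by omega] at this
  have h4 := hsearch 8 o' (by decide) fun _ _ => rfl
  have hd : decide (([s] : List ℕ)[0]? = some s) = true := by simp
  have h5 : Leads k x (conf k 8 s [s] o') (conf k 10 (s + 2 * 0) [s, s + 2 * 0] o') := by
    simpa using leads_push (k := k) (q := 8) (q' := 10) (p := [s]) (o := o') (w := [])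
      (by decide) (h.marker 0 hR) (by simp) (by rw [Nat.mul_zero, Nat.add_zero, hd]; rfl)
  have h6 := leads_backward (k := k) h o' (R.length - 1) 0 (by omega)
  rw [Nat.sub_add_cancel hR] at h6
  set o'' := o' ++ strPow R.reverse R.length with ho''
  have h7 : Leads k x (conf k 17 (s + 2 * R.length) [s] o'')
      (conf k 19 (s + 2 * R.length - 1) [s] o'') := by
    simpa using leads_left (k := k) (q := 17) (p := [s]) (o := o'') (by decide) h.separator rfl
  have h8 := hsearch 19 o'' (by decide) fun _ _ => rfl
  have h9 : Leads k x (conf k 19 s [s] o'') (conf k 20 (s + 2 * 0) [] o'') := by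
    simpa using leads_pop (k := k) (q := 19) (q' := 20) (p := []) (o := o'') (w := [])
      (by decide) (h.marker 0 hR) (by rw [Nat.mul_zero, Nat.add_zero, List.nil_append, hd]; rfl)
  have h10 := leads_separator (k := k) (q := 20) (q' := 21) (by decide) (by decide)
    (fun _ _ => rfl) (fun _ _ _ => rfl) h [] o'' R.length 0 (by omega)
  have h11 := leads_right (k := k) (q := 20) (p := []) (o := o'') (by decide) h.separator rfl
  have e : o ++ block k R = o'' ++ [] := by simp [block, o'', o']
  rw [e]
  exact h1.trans (h2.trans (h3.trans (h4.trans (h5.trans (h6.trans (h7.trans (h8.trans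
    (h9.trans (h10.trans h11)))))))))

/-! ### The input -/

/-- The cells of `R`. -/
def cells (R : Str) : Str := R.flatMap fun b => [true, b]

@[simp] theorem length_cells (R : Str) : (cells R).length = 2 * R.length := by
  simp [cells, List.length_flatMap]; ring

/-- The input for the strings in `Rs` and a string `t` to be copied. -/
def encode (Rs : List Str) (t : Str) : Str := (Rs.flatMap fun R => cells R ++ [false]) ++ false :: t

theorem tapeSymbol_append (v : Str) (b : Bool) (w : Str) :
    tapeSymbol (v ++ b :: w) (v.length + 1) = .bit b := by
  simp [tapeSymbol]

theorem onTape (v R w : Str) : OnTape (v ++ (cells R ++ false :: w)) (v.length + 1) R := by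
  induction R generalizing v with
  | nil => exact ⟨by simp, by simp, tapeSymbol_append v false w⟩
  | cons b R ih =>
    have h := ih (v ++ [true, b])
    have e : v ++ [true, b] ++ (cells R ++ false :: w) = v ++ (cells (b :: R) ++ false :: w) := by
      simp [cells]
    rw [e, List.length_append] at h
    simp only [List.length_cons, List.length_nil] at h
    refine ⟨fun i hi => ?_, fun i hi => ?_, ?_⟩
    · cases i with
      | zero => simpa [cells] using tapeSymbol_append v true (b :: (cells R ++ false :: w))
      | succ i =>
        rw [← h.marker i (by simpa using hi)]; congr 1; ring
    · cases i with
      | zero =>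
        simpa [cells] using tapeSymbol_append (v ++ [true]) b (cells R ++ false :: w)
      | succ i =>
        rw [List.getElem_cons_succ, ← h.bit i (by simpa using hi)]; congr 1; ring
    · rw [← h.separator, List.length_cons]; congr 1; ring

theorem leads_blocks (v : Str) (Rs : List Str) (w o : Str) (hRs : ∀ R ∈ Rs, 0 < R.length) :
    Leads k (v ++ ((Rs.flatMap fun R => cells R ++ [false]) ++ w)) (conf k 1 (v.length + 1) [] o)
      (conf k 1 (v.length + (Rs.flatMap fun R => cells R ++ [false]).length + 1) []
        (o ++ Rs.flatMap (block k))) := by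
  induction Rs generalizing v o with
  | nil => simpa using Leads.refl _
  | cons R Rs ih =>
    have h1 := leads_block (k := k)
      (onTape v R ((Rs.flatMap fun R => cells R ++ [false]) ++ w)) (hRs R (by simp)) o
    have h2 := ih (v ++ (cells R ++ [false])) (o ++ block k R) fun R hR => hRs R (by simp [hR])
    simp only [List.flatMap_cons, List.length_append, length_cells, List.length_cons,
      List.length_nil, List.append_assoc, List.cons_append, List.nil_append] at h1 h2 ⊢
    refine h1.trans ?_
    convert h2 using 2 <;> ring

theorem leads_copy (v t o : Str) :
    Leads k (v ++ t) (conf k 18 (v.length + 1) [] o)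
      (conf k 22 (v.length + t.length) [] (o ++ t)) := by
  induction t generalizing v o with
  | nil =>
    refine Relation.ReflTransGen.single ?_
    have : tapeSymbol (v ++ []) (v.length + 1) = .rightEnd := by simp [tapeSymbol]
    rw [step_eq (by decide), this]
    rfl
  | cons b t ih =>
    have h1 := leads_right (k := k) (q := 18) (p := []) (o := o) (by decide)
      (tapeSymbol_append v b t) rfl
    have h2 := ih (v ++ [b]) (o ++ [b])
    simp only [List.length_append, List.length_cons, List.length_nil, List.append_assoc,
      List.cons_append, List.nil_append] at h2 ⊢
    refine h1.trans ?_
    convert h2 using 2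
    ring

theorem outputs_encode (Rs : List Str) (t : Str) (hRs : ∀ R ∈ Rs, 0 < R.length) :
    (transducer k).Outputs (encode Rs t) (Rs.flatMap (block k) ++ t) := by
  have h1 : Leads k (encode Rs t) (conf k 0 0 [] []) (conf k 1 1 [] []) :=
    Relation.ReflTransGen.single (by rw [step_eq (by decide)]; rfl)
  have h2 := leads_blocks (k := k) [] Rs (false :: t) [] hRs
  have h3 := leads_right (k := k) (q := 1) (p := []) (o := Rs.flatMap (block k)) (by decide)
    (tapeSymbol_append (Rs.flatMap fun R => cells R ++ [false]) false t) rfl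
  have h4 := leads_copy (k := k) ((Rs.flatMap fun R => cells R ++ [false]) ++ [false]) t
    (Rs.flatMap (block k))
  simp only [List.nil_append, List.length_nil, Nat.zero_add, List.append_nil,
    List.length_append, List.length_cons, List.append_assoc, List.cons_append] at h2 h3 h4
  exact ⟨_, h1.trans (h2.trans (h3.trans h4)), Finset.mem_singleton_self _, rfl⟩

end Expander

/-! ## Lower bounds -/

theorem notMem_of_notMem_withReverse {B : ℕ → Set Str} {u : ℕ} {x w : Str}
    (h : x ∉ withReverse B u) (hw : w = x ∨ w = x.reverse) : w ∉ B u := by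
  rcases hw with rfl | rfl
  · exact fun hx => h (Or.inl hx)
  · exact fun hx => h (Or.inr ⟨_, hx, List.reverse_reverse x⟩)

theorem IsBlockSequence.eventually_le_of_output_eq {S : BitSeq} {k : ℕ} {R : ℕ → Str}
    (h : IsBlockSequence S k R) (hk : 8 < k) (T : FST)
    (hT : ∀ᶠ u in atTop, R u ∉ withReverse (T.compressible k) u) :
    ∀ᶠ n in atTop, ∀ y, T.output y = seqPrefix S n → (k - 4) * n ≤ k * y.length := by
  obtain ⟨u₀, hu₀⟩ := eventually_atTop.1 hT
  filter_upwards [h.eventually_le hk u₀] with n hn y hy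
  refine (hn (T.progress y) (T.monotone_progress y) fun j p w hj hw hocc hpn _ => ?_).trans
    (Nat.mul_le_mul_left _ (T.progress_le y n))
  obtain ⟨t, ht, -⟩ := exists_seqPrefix_eq_append S hpn
  have hlen : w.length = k * scale k j := by
    rw [← h.length_eq _ (scale_pos (by omega) j)]
    rcases hw with rfl | rfl <;> simp
  have hsj : u₀ ≤ scale k j := hj.le.trans (le_scale (by omega) j)
  rw [hocc.seqPrefix_add, ← hy, List.append_assoc] at ht
  simpa using T.le_progress ht hlen (notMem_of_notMem_withReverse (hu₀ _ hsj) hw)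

/-- A bound for the height of a stack that grows by at most `E` symbols per bit. -/
def heightBound (k E u : ℕ) : ℕ := E * (u * (2 * (k * u) ^ 2 + k)) + 1

theorem heightBound_le (k E : ℕ) {u : ℕ} (hu : 0 < u) :
    heightBound k E u ≤ (E * (2 * k ^ 2 + k) + 1) * u ^ 3 := by
  have h1 : u ≤ u ^ 3 := Nat.le_self_pow (by norm_num) u
  have h2 : 1 ≤ u ^ 3 := Nat.one_le_pow _ _ hu
  have h3 : E * k * u ≤ E * k * u ^ 3 := Nat.mul_le_mul_left _ h1
  unfold heightBound
  nlinarith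

namespace UnaryPushdownCompressor

theorem run_seqPrefix {C : UnaryPushdownCompressor} {S : BitSeq} {p : ℕ} {w : Str}
    {y : C.Config} (h : seqPrefix S (p + w.length) = seqPrefix S p ++ w)
    (hy : C.run (seqPrefix S p) = some y) :
    C.run (seqPrefix S (p + w.length)) = C.runFrom y w := by
  rw [h, PDC.run_eq, PDCData.run_append, ← PDC.run_eq, hy, Option.bind_some]

theorem output_eq {C : UnaryPushdownCompressor} {x : Str} {y : C.Config}
    (h : C.run x = some y) : C.output x = y.out := by
  rw [PDC.output, h]

theorem monotone_length_output {C : UnaryPushdownCompressor} (hC : C.IsLossless) (S : BitSeq) :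
    Monotone fun n => (C.output (seqPrefix S n)).length := by
  intro m n hmn
  obtain ⟨t, ht, hlen⟩ := exists_seqPrefix_eq_append S hmn
  obtain ⟨y, hy⟩ := hC.1 (seqPrefix S m)
  obtain ⟨z, hz⟩ := hC.1 (seqPrefix S n)
  have h := hz
  rw [ht, PDC.run_eq, PDCData.run_append, ← PDC.run_eq, hy, Option.bind_some] at h
  simp only [output_eq hy, output_eq hz]
  exact (C.out_prefix_of_runFrom h).length_le

end UnaryPushdownCompressor

theorem IsBlockSequence.eventually_le_length_output {S : BitSeq} {k : ℕ} {R : ℕ → Str}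
    (h : IsBlockSequence S k R) (hk : 8 < k) {C : UnaryPushdownCompressor} (hC : C.IsLossless)
    (hav : ∀ E, ∀ᶠ u in atTop, R u ∉ withReverse (C.compressible k (heightBound k E)) u) :
    ∀ᶠ n in atTop, (k - 4) * n ≤ k * (C.output (seqPrefix S n)).length := by
  have hk1 : 1 < k := by omega
  obtain ⟨E, hE⟩ := C.exists_length_stack_le
  obtain ⟨u₀, hu₀⟩ := eventually_atTop.1 (hav E)
  filter_upwards [h.eventually_le hk u₀] with n hn
  refine hn (fun n => (C.output (seqPrefix S n)).length)
    (UnaryPushdownCompressor.monotone_length_output hC S) fun j p w hj hw hocc _ hpj => ?_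
  have hlen : w.length = k * scale k j := by
    rw [← h.length_eq _ (scale_pos hk1 j)]
    rcases hw with rfl | rfl <;> simp
  have hsj : u₀ ≤ scale k j := hj.le.trans (le_scale hk1 j)
  obtain ⟨y, hy⟩ := hC.1 (seqPrefix S p)
  obtain ⟨z, hz⟩ := hC.1 (seqPrefix S (p + w.length))
  simp only [UnaryPushdownCompressor.output_eq hy, UnaryPushdownCompressor.output_eq hz]
  rw [UnaryPushdownCompressor.run_seqPrefix hocc.seqPrefix_add hy] at hz
  by_contra hlt
  refine notMem_of_notMem_withReverse (hu₀ _ hsj) hw ⟨hlen, _, y, z, hy, hz, ?_, by omega⟩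
  refine (hE _ _ hy).trans ?_
  rw [length_seqPrefix, heightBound]
  have h1 : p ≤ scale k j * blockLength k j := by
    have := totalLength_le hk1 j
    omega
  exact Nat.add_le_add_right (Nat.mul_le_mul_left _ h1) 1

/-- The families of strings that the strings `R u` have to avoid. -/
def compressibleFamilies (k : ℕ) : Set (ℕ → Set Str) :=
  Set.range (fun T : FST => withReverse (T.compressible k)) ∪
    {B | ∃ C : UnaryPushdownCompressor, C.IsLossless ∧
      ∃ E, B = withReverse (C.compressible k (heightBound k E))}

theorem countable_compressibleFamilies (k : ℕ) : (compressibleFamilies k).Countable := by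
  refine (Set.countable_range _).union (Set.Countable.mono ?_ (Set.countable_range
    fun p : PDCData.Code Unit × ℕ =>
      withReverse ((PDCData.ofCode p.1).compressible k (heightBound k p.2))))
  rintro _ ⟨C, -, E, rfl⟩
  obtain ⟨n, e, d, hd⟩ := C.exists_rename_eq_ofCode
  exact ⟨(d, E), by simp only [← hd, PDCData.compressible_rename]⟩

theorem isSmall_of_mem_compressibleFamilies {k : ℕ} {B : ℕ → Set Str}
    (hB : B ∈ compressibleFamilies k) : IsSmall k B := by
  rcases hB with ⟨T, rfl⟩ | ⟨C, hC, E, rfl⟩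
  · exact (T.isSmall_compressible k).withReverse
  · exact (UnaryPushdownCompressor.isSmall_compressible hC k
      fun u hu => heightBound_le k E hu).withReverse

/-! ## Depth -/

theorem IsBlockSequence.eventually_exists_encode {S : BitSeq} {k : ℕ} {R : ℕ → Str}
    (h : IsBlockSequence S k R) (hk : 1 < k) :
    ∀ᶠ n in atTop, ∃ y, (Expander.transducer k).Outputs y (seqPrefix S n) ∧
      k * y.length ≤ n := by
  filter_upwards [eventually_exists_block hk (3 * k) 0] with n hn
  obtain ⟨j, -, h1, h2, h3⟩ := hn
  obtain ⟨t, ht, hlen⟩ := exists_seqPrefix_eq_append S h1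
  rw [h.seqPrefix_totalLength hk] at ht
  refine ⟨Expander.encode ((List.range j).map fun i => R (scale k (i + 1))) t, ?_, ?_⟩
  · have := Expander.outputs_encode (k := k)
      ((List.range j).map fun i => R (scale k (i + 1))) t (by
        simp only [List.mem_map, forall_exists_index, and_imp]
        rintro _ i - rfl
        rw [h.length_eq _ (scale_pos hk _)]
        exact Nat.mul_pos (by omega) (scale_pos hk _))
    rwa [List.flatMap_map, ← blockPrefix.eq_1 (fun j => block k (R (scale k j))), ← ht] at this
  · set l := k * scale k (j + 1) with hl
    have hjl : j + 1 ≤ l :=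
      (le_scale hk (j + 1)).trans (Nat.le_mul_of_pos_left _ (by omega))
    have hcells : ∀ m ≤ j, (((List.range m).map fun i => R (scale k (i + 1))).flatMap
        fun R => Expander.cells R ++ [false]).length ≤ m * (2 * l + 1) := by
      intro m
      induction m with
      | zero => simp
      | succ m ih =>
        intro hm
        have h4 : scale k (m + 1) ≤ scale k (j + 1) :=
          Nat.pow_le_pow_right (by omega) (Nat.clog_mono_right k (by omega))
        have h5 : k * scale k (m + 1) ≤ l := Nat.mul_le_mul_left _ h4
        have h6 := ih (by omega)
        rw [List.range_succ, List.map_append, List.flatMap_append, List.length_append,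
          Nat.succ_mul]
        simp only [List.map_cons, List.map_nil, List.flatMap_cons, List.flatMap_nil,
          List.append_nil, List.length_append, Expander.length_cells, List.length_cons,
          List.length_nil, h.length_eq _ (scale_pos hk (m + 1))]
        omega
    have h4 := hcells j le_rfl
    have h5 : blockLength k (j + 1) = 2 * l ^ 2 + k := rfl
    have h6 : j * (2 * l + 1) + (2 * l + 1) ≤ l * (2 * l + 1) := by
      rw [← Nat.succ_mul]; exact Nat.mul_le_mul_right _ hjl
    rw [totalLength_succ] at h2
    have h7 : (Expander.encode ((List.range j).map fun i => R (scale k (i + 1))) t).length ≤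
        3 * blockLength k (j + 1) := by
      have h8 : t.length ≤ blockLength k (j + 1) := by omega
      have h9 : l * (2 * l + 1) = 2 * l ^ 2 + l := by ring
      rw [Expander.encode, List.length_append, List.length_cons]
      omega
    calc _ ≤ k * (3 * blockLength k (j + 1)) := Nat.mul_le_mul_left _ h7
      _ = 3 * k * blockLength k (j + 1) := by ring
      _ ≤ n := h3.trans h1

theorem BinaryRep.exists_length_eq_size {F : Type} (σ : BinaryRep F) (T : F) :
    ∃ x : σ.dom, σ.toFun x = T ∧ (x : Str).length = σ.size T := by
  obtain ⟨x, hx⟩ := σ.surjective T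
  exact Nat.sInf_mem (s := {m : ℕ | ∃ x : σ.dom, σ.toFun x = T ∧ (x : Str).length = m})
    ⟨_, x, hx, rfl⟩

theorem BinaryRep.finite_size_le {F : Type} (σ : BinaryRep F) (k : ℕ) :
    {T | σ.size T ≤ k}.Finite := by
  choose f hf hlen using σ.exists_length_eq_size
  refine Set.Finite.of_injOn (f := fun T => (f T : Str)) (t := shortStrs (k + 1)) ?_ ?_
    (Finset.finite_toSet _)
  · intro T hT
    have : σ.size T ≤ k := hT
    simp only [SetLike.mem_coe, mem_shortStrs, hlen]
    omega
  · intro T _ T' _ h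
    rw [← hf T, ← hf T', Subtype.ext h]

theorem toEReal_natCast (m : ℕ) : toEReal (m : ℕ∞) = ((m : ℝ) : EReal) := by
  simp [toEReal]
  rfl

theorem toEReal_mono {m n : ℕ∞} (h : m ≤ n) : toEReal m ≤ toEReal n := by
  simpa [toEReal] using h

theorem le_toEReal_sub_toEReal {m n : ℕ∞} {a b : ℕ} {r : ℝ} (ha : (a : ℕ∞) ≤ m)
    (hb : n ≤ (b : ℕ∞)) (hr : r ≤ (a : ℝ) - b) : (r : EReal) ≤ toEReal m - toEReal n := by
  have h1 := toEReal_mono ha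
  have h2 := toEReal_mono hb
  rw [toEReal_natCast] at h1 h2
  refine le_trans ?_ (EReal.sub_le_sub h1 h2)
  rw [← EReal.coe_sub]
  exact EReal.coe_le_coe_iff.2 hr

theorem IsBlockSequence.pbDepthGE {S : BitSeq} {k : ℕ} {R : ℕ → Str}
    (h : IsBlockSequence S k R) (hk : 8 < k)
    (hT : ∀ T : FST, ∀ᶠ u in atTop, R u ∉ withReverse (T.compressible k) u) {β : ℝ}
    (hβ : 8 / (k : ℝ) ≤ β) (σ : BinaryRep FST) (τ : BinaryRep PebbleTransducer) :
    PBDepthGE σ τ S (1 - β) := by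
  intro m
  refine ⟨τ.size (Expander.transducer k), ?_⟩
  have hk0 : (0 : ℝ) < k := by exact_mod_cast (by omega : 0 < k)
  filter_upwards [(σ.finite_size_le m).eventually_all.2 fun T _ =>
      h.eventually_le_of_output_eq hk T (hT T), h.eventually_exists_encode (by omega)]
    with n h1 h2
  obtain ⟨y, hy, hyn⟩ := h2
  refine le_toEReal_sub_toEReal (a := ⌈(1 - 4 / (k : ℝ)) * n⌉₊) (b := y.length) ?_ ?_ ?_
  · refine le_iInf₂ fun z ⟨T, hTm, hz⟩ => ?_
    have h3 := h1 T hTm z hz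
    rw [Nat.cast_le, Nat.ceil_le]
    have h4 : (((k - 4) * n : ℕ) : ℝ) ≤ ((k * z.length : ℕ) : ℝ) := Nat.cast_le.2 h3
    push_cast [Nat.cast_sub (show 4 ≤ k by omega)] at h4
    rw [show (1 - 4 / (k : ℝ)) * n = ((k : ℝ) - 4) * n / k by field_simp]
    rw [div_le_iff₀ hk0]
    linarith
  · exact iInf₂_le y ⟨_, le_rfl, hy⟩
  · have h3 := Nat.le_ceil ((1 - 4 / (k : ℝ)) * n)
    have h4 : (y.length : ℝ) ≤ n / k := by
      rw [le_div_iff₀ hk0, mul_comm]; exact_mod_cast hyn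
    have h5 : 8 / (k : ℝ) * n ≤ β * n := mul_le_mul_of_nonneg_right hβ (Nat.cast_nonneg n)
    have h6 : 0 ≤ (n : ℝ) / k := by positivity
    have h7 : 8 / (k : ℝ) * n = 8 * (n / k) := by ring
    have h8 : (1 - 4 / (k : ℝ)) * n = n - 4 * (n / k) := by ring
    linarith

theorem IsBlockSequence.pdDepthGE {S : BitSeq} {k : ℕ} {R : ℕ → Str}
    (h : IsBlockSequence S k R) (hk : 8 < k) (hR : ∀ u, 0 < u → R u ∈ candidates k u)
    (hav : ∀ C : UnaryPushdownCompressor, C.IsLossless → ∀ E,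
      ∀ᶠ u in atTop, R u ∉ withReverse (C.compressible k (heightBound k E)) u) {β : ℝ}
    (hβ : 8 / (k : ℝ) ≤ β) : PDDepthGE S (1 / 2 - β) := by
  intro C hC
  have : NeZero k := ⟨by omega⟩
  refine ⟨Mirror.compressor k, Mirror.isLossless_compressor k, ?_⟩
  have hk0 : (0 : ℝ) < k := by exact_mod_cast (by omega : 0 < k)
  filter_upwards [h.eventually_le_length_output hk hC (hav C hC),
    h.eventually_mirror_le (by omega) hR] with n h1 h2
  generalize (C.output (seqPrefix S n)).length = a at *
  generalize ((Mirror.compressor k).output (seqPrefix S n)).length = b at *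
  have h3 : (((k - 4) * n : ℕ) : ℝ) ≤ ((k * a : ℕ) : ℝ) := Nat.cast_le.2 h1
  have h4 : ((2 * k * b : ℕ) : ℝ) ≤ (((k + 5) * n : ℕ) : ℝ) := Nat.cast_le.2 h2
  push_cast [Nat.cast_sub (show 4 ≤ k by omega)] at h3 h4
  have h5 : 8 * (n : ℝ) ≤ k * β * n := by
    have := mul_le_mul_of_nonneg_right hβ (Nat.cast_nonneg (α := ℝ) n)
    rw [div_mul_eq_mul_div, div_le_iff₀ hk0] at this
    linarith
  have h6 : (0 : ℝ) ≤ n := Nat.cast_nonneg n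
  refine le_of_mul_le_mul_left ?_ hk0
  nlinarith

end PebbleDepth

theorem mainTheorem5 (U : PebbleDepth.Str →. PebbleDepth.Str) (hU : PebbleDepth.IsUniversal U)
    (β : ℝ) (hβ₀ : 0 < β) (hβ₁ : β < 1 / 2) :
    ∃ S : PebbleDepth.BitSeq,
      (∃ k : ℕ, 8 < k ∧ 8 / (k : ℝ) ≤ β ∧ ∃ R : ℕ → PebbleDepth.Str,
        (∀ j : ℕ, 1 ≤ j →
          (R j).length = k * k ^ Nat.clog k j ∧
          ¬ List.replicate k true <:+: R j ∧
          (PebbleDepth.kolmogorov U (R j) : ℝ) ≥ ((R j).length : ℝ) * (1 - 1 / (k : ℝ))) ∧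
        PebbleDepth.IsConcatenation S fun j => PebbleDepth.block k (R j)) ∧
      (∀ (σ : PebbleDepth.BinaryRep PebbleDepth.FST)
        (τ : PebbleDepth.BinaryRep PebbleDepth.PebbleTransducer),
        PebbleDepth.PBDepthGE σ τ S (1 - β)) ∧
      PebbleDepth.PDDepthGE S (1 / 2 - β) := by
  open PebbleDepth in
  obtain ⟨k, hk⟩ := exists_nat_ge (8 / β)
  have hk0 : (0 : ℝ) < k := lt_of_lt_of_le (by positivity) hk
  have hkβ : 8 / (k : ℝ) ≤ β := by
    rw [div_le_iff₀ hβ₀] at hk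
    rw [div_le_iff₀ hk0]
    linarith
  have hk8 : 8 < k := by
    rw [div_le_iff₀ hk0] at hkβ
    have : (8 : ℝ) < k := by nlinarith
    exact_mod_cast this
  have hk1 : 1 < k := by omega
  obtain ⟨R, hR, hav⟩ := exists_avoiding hU (show 2 < k by omega)
    (countable_compressibleFamilies k) fun B hB =>
      (isSmall_of_mem_compressibleFamilies hB).eventually (by omega)
  obtain ⟨S, hS⟩ := exists_occurs_blockPrefix (B := fun j => block k (R (scale k j)))
    fun j => by
      simp only [block, List.length_append, List.length_replicate]
      omega
  have hseq : IsBlockSequence S k R := ⟨fun u hu => (hR u hu).1.1, hS⟩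
  refine ⟨S, ⟨k, hk8, hkβ, fun j => R (scale k j), fun j _ => ?_,
    fun m => seqPrefix_of_occurs_zero (hS m)⟩, fun σ τ => ?_, ?_⟩
  · obtain ⟨⟨h1, h2, -⟩, h3⟩ := hR _ (scale_pos hk1 j)
    refine ⟨h1, h2, ?_⟩
    have h4 : (((k - 1) * scale k j : ℕ) : ℝ) ≤ kolmogorov U (R (scale k j)) := Nat.cast_le.2 h3
    rw [h1]
    push_cast [Nat.cast_sub hk1.le] at h4 ⊢
    have h5 : (k : ℝ) * scale k j * (1 - 1 / k) = (k - 1) * scale k j := by field_simp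
    rw [h5]
    exact h4
  · exact hseq.pbDepthGE hk8 (fun T => hav _ (Or.inl ⟨T, rfl⟩)) hkβ σ τ
  · exact hseq.pdDepthGE hk8 (fun u hu => (hR u hu).1)
      (fun C hC E => hav _ (Or.inr ⟨C, hC, E, rfl⟩)) hkβ
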